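/- Let $\alpha>2$, $\lambda>0$, let $L\ge 1$ be an integer, and put $\delta=2/\alpha$ and $c_1=\pi\,\Gamma(\delta+1)$. Let the interfering transmitters $T_1,T_2,\dots$ form a homogeneous Poisson point process of density $\lambda$ on $\mathbb R^2$, and let $\rho_1,\rho_2,\dots$ be i.i.d. exponential random variables with mean $1$, independent of $(T_n)_n$. The (effective) interference power of $T_n$ at the receiver located at the origin is $I_n=|T_n|^{-\alpha}\rho_n$. The receiver cancels the $L-1$ strongest interferers, that is, those with the $L-1$ largest values $I_n$. Let $G$ (the primary interference power) be the power of the strongest remaining interferer, i.e. the $L$-th largest of the $I_n$, and let $I_\Pi=\sum_{n:\,I_n<G}I_n$ (the secondary interference power) be the total power of all weaker interferers. Then: 1. $G$ has the probability density $$f_G(g)=\frac{\delta\,c_1^L\lambda^L g^{-\delta L-1}}{\Gamma(L)}\exp\left(-c_1\lambda g^{-\delta}\right),\qquad g>0.$$ 2. $I_\Pi$ is almost surely finite and, conditioned on $G=g$ (for almost every $g>0$), it has a finite second moment, with mean and variance $$\mathbf E[I_\Pi\mid G=g]=\frac{2\pi\lambda\,\Gamma(\delta+1)}{\alpha-2}\,g^{1-\delta},\qquad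 \mathrm{Var}(I_\Pi\mid G=g)=\frac{\pi\,\Gamma(\delta+1)\,\lambda}{\alpha-1}\,g^{2-\delta}.$$ -/

import Mathlib

open MeasureTheory ProbabilityTheory Set

noncomputable section

/-- The plane with its Euclidean norm. -/
abbrev Plane : Type := EuclideanSpace ℝ (Fin 2)

/-- Number of points of the sequence `T` (at the outcome `ω`) that lie in `B`. -/
def pointCount {Ω : Type*} (T : ℕ → Ω → Plane) (B : Set Plane) (ω : Ω) : ℕ∞ :=
  {n : ℕ | T n ω ∈ B}.encard

/-- The random points `T 0, T 1, …` form a homogeneous Poisson point process on the plane with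
density `lam`: the number of points in a Borel set of finite area is Poisson distributed with mean
`lam` times the area, and the numbers of points in disjoint Borel sets are independent. -/
structure IsHomogeneousPoissonProcess {Ω : Type*} [MeasurableSpace Ω] (μ : Measure Ω)
    (lam : ℝ) (T : ℕ → Ω → Plane) : Prop where
  measurable_point : ∀ n, Measurable (T n)
  count_poisson : ∀ B : Set Plane, MeasurableSet B → volume B < ⊤ → ∀ k : ℕ,
    μ.real {ω | pointCount T B ω = (k : ℕ∞)} =
      Real.exp (-(lam * volume.real B)) * (lam * volume.real B) ^ k / (k.factorial : ℝ)
  count_indep : ∀ (m : ℕ) (B : Fin m → Set Plane), (∀ i, MeasurableSet (B i)) →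
    Pairwise (Function.onFun Disjoint B) → iIndepFun (fun i => pointCount T (B i)) μ

/-- The interferers seen by the receiver at the origin: their positions `T n` form a homogeneous
Poisson point process of density `lam`, and their fading powers `ρ n` are i.i.d. exponential with
unit mean (and variance) and independent of the positions. -/
structure IsInterfererField {Ω : Type*} [MeasurableSpace Ω] (μ : Measure Ω)
    (lam : ℝ) (T : ℕ → Ω → Plane) (ρ : ℕ → Ω → ℝ) : Prop where
  poisson : IsHomogeneousPoissonProcess μ lam T
  measurable_fading : ∀ n, Measurable (ρ n)
  fading_law : ∀ n, μ.map (ρ n) = expMeasure 1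
  fading_indep : iIndepFun ρ μ
  points_indep_fading : IndepFun (fun ω n => T n ω) (fun ω n => ρ n ω) μ

/-- Effective interference power `r ^ (-α) * ρ` received at the origin from the `n`-th node, which
is at distance `r` from the origin. -/
def interferencePower {Ω : Type*} (α : ℝ) (T : ℕ → Ω → Plane) (ρ : ℕ → Ω → ℝ)
    (n : ℕ) (ω : Ω) : ℝ :=
  ‖T n ω‖ ^ (-α) * ρ n ω

/-- The `L`-th largest term of a sequence (`L ≥ 1`, terms counted with multiplicity) of
nonnegative reals tending to `0`: the least level `x ≥ 0` that is exceeded by fewer than `L`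
terms. -/
def nthLargest (L : ℕ) (a : ℕ → ℝ) : ℝ :=
  sInf {x : ℝ | 0 ≤ x ∧ {n : ℕ | x < a n}.encard < (L : ℕ∞)}

/-- Primary interference power: the power of the strongest interferer that remains when the
`L - 1` strongest interferers have been canceled, i.e. of the `L`-th strongest one. -/
def primaryPower {Ω : Type*} (L : ℕ) (α : ℝ) (T : ℕ → Ω → Plane) (ρ : ℕ → Ω → ℝ) (ω : Ω) : ℝ :=
  nthLargest L (fun n => interferencePower α T ρ n ω)

/-- Contribution of the `n`-th node to the secondary interference: its power if it is weaker than
the primary interferer, and `0` otherwise. -/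
def secondaryTerm {Ω : Type*} (L : ℕ) (α : ℝ) (T : ℕ → Ω → Plane) (ρ : ℕ → Ω → ℝ)
    (ω : Ω) (n : ℕ) : ℝ :=
  {m : ℕ | interferencePower α T ρ m ω < primaryPower L α T ρ ω}.indicator
    (fun m => interferencePower α T ρ m ω) n

/-- Secondary interference power: the total power of all interferers that are weaker than the
primary one. -/
def secondaryPower {Ω : Type*} (L : ℕ) (α : ℝ) (T : ℕ → Ω → Plane) (ρ : ℕ → Ω → ℝ)
    (ω : Ω) : ℝ :=
  ∑' n, secondaryTerm L α T ρ ω n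

/-- The density of the primary interference power, with `δ = 2 / α` and `c₁ = π Γ(δ + 1)`. -/
def primaryDensity (L : ℕ) (α lam g : ℝ) : ℝ :=
  let δ : ℝ := 2 / α
  let c₁ : ℝ := Real.pi * Real.Gamma (δ + 1)
  δ * c₁ ^ L * lam ^ L * g ^ (-δ * (L : ℝ) - 1) / Real.Gamma (L : ℝ) *
    Real.exp (-(c₁ * lam * g ^ (-δ)))

end

/-! Write δ = 2/α and c = π Γ(δ+1) λ. The powers are the image of the marked points (T_n, ρ_n) under
(t, r) ↦ |t|^(-α) r, so they form a Poisson process on the line with intensity Λ, the image of λ ·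
area ⊗ Exp(1). For r > 0 the region |t|^(-α) r > x is a punctured disc of area π (r/x)^δ, and E ρ^δ
= Γ(δ+1); hence Λ((x, ∞)) = c x^(-δ) (`powerIntensity_Ioi`). The Poisson property enters only
through the generating functional E ∏ (1 - v(I_n)) = exp(-∫ v dΛ)
(`IsInterfererField.lintegral_infProd_power`, abstracted as `HasPoissonFunctional`).

One choice of v yields the joint transform E[z^N e^(-sS)], where N counts the points above a and S
sums the points of (0, g], g ≤ a. It factorizes, so N is Poisson and independent of S
(`HasPoissonFunctional.setLIntegral_expNeg`). Since G ≤ x almost surely means that fewer than L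
points exceed x, P(G ≤ x) is a Poisson distribution function evaluated at c x^(-δ); its derivative
telescopes to the stated density (`HasPoissonFunctional.map_nthLargest`).

For the conditional moments, fix g first. The events {G ≤ a}, a ≥ g, determine the law of G above g,
so the moments of S factorize over {G ∈ A} for every Borel A ⊆ (g, ∞). The mean and variance of S
are ∫ y dΛ and ∫ y² dΛ over (0, g], read off from the Laplace transform near 0. The random level G
is then approximated by dyadic levels strictly below it: on each dyadic cell the level is
deterministic, and monotone convergence leads to the sum of the points strictly below G
(`HasPoissonFunctional.setLIntegral_sumStrictlyBelow_pow`). Integrals over all Borel events of G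
determine the moments of the regular conditional distribution almost everywhere
(`ae_lintegral_condDistrib_eq`). -/

open Filter Topology
open scoped ENNReal

/-! ### Infinite products of numbers in [0, 1] -/

/-- The infinite product of a sequence of numbers in `[0, 1]`, as the infimum of its partial
products. -/
noncomputable def infProd (h : ℕ → ℝ≥0∞) : ℝ≥0∞ := ⨅ N, ∏ n ∈ Finset.range N, h n

theorem antitone_partialProd {h : ℕ → ℝ≥0∞} (h1 : ∀ n, h n ≤ 1) :
    Antitone (fun N => ∏ n ∈ Finset.range N, h n) :=
  antitone_nat_of_succ_le fun N => by
    rw [Finset.prod_range_succ]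
    exact mul_le_of_le_one_right' (h1 N)

theorem tendsto_infProd {h : ℕ → ℝ≥0∞} (h1 : ∀ n, h n ≤ 1) :
    Tendsto (fun N => ∏ n ∈ Finset.range N, h n) atTop (𝓝 (infProd h)) :=
  tendsto_atTop_iInf (antitone_partialProd h1)

theorem infProd_le_one (h : ℕ → ℝ≥0∞) : infProd h ≤ 1 :=
  (iInf_le _ 0).trans (by simp)

theorem infProd_finset_prod {ι : Type*} (s : Finset ι) {h : ι → ℕ → ℝ≥0∞}
    (h1 : ∀ i n, h i n ≤ 1) :
    infProd (fun n => ∏ i ∈ s, h i n) = ∏ i ∈ s, infProd (h i) := by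
  refine tendsto_nhds_unique (tendsto_infProd fun n => Finset.prod_le_one' fun i _ => h1 i n) ?_
  simp_rw [Finset.prod_comm (t := s)]
  exact ENNReal.tendsto_finsetProd_of_ne_top s (fun i _ => tendsto_infProd (h1 i))
    fun i _ => ((infProd_le_one _).trans_lt ENNReal.one_lt_top).ne

theorem infProd_mul {h k : ℕ → ℝ≥0∞} (hh : ∀ n, h n ≤ 1) (hk : ∀ n, k n ≤ 1) :
    infProd (fun n => h n * k n) = infProd h * infProd k := by
  have := infProd_finset_prod (Finset.univ : Finset Bool) (h := fun b => if b then h else k)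
    (by rintro (_ | _) n <;> simp [hh, hk])
  simpa using this

/-- The infima over k and over the length N commute, and for fixed N a finite product of decreasing
sequences in [0, 1] passes to the limit. -/
theorem infProd_iInf {h : ℕ → ℕ → ℝ≥0∞} (h1 : ∀ k n, h k n ≤ 1)
    (ha : ∀ n, Antitone (fun k => h k n)) :
    infProd (fun n => ⨅ k, h k n) = ⨅ k, infProd (h k) := by
  unfold infProd
  rw [iInf_comm]
  congr 1 with N
  have hl : Tendsto (fun k => ∏ n ∈ Finset.range N, h k n) atTop
      (𝓝 (∏ n ∈ Finset.range N, ⨅ k, h k n)) :=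
    ENNReal.tendsto_finsetProd_of_ne_top _ (fun n _ => tendsto_atTop_iInf (ha n))
      fun n _ => ((iInf_le _ 0).trans_lt ((h1 0 n).trans_lt ENNReal.one_lt_top)).ne
  refine tendsto_nhds_unique hl (tendsto_atTop_iInf fun k l hkl => ?_)
  exact Finset.prod_le_prod' fun n _ => ha n hkl

-- Finiteness is essential: `ncard` of an infinite set is 0, whereas the product then vanishes for z
-- < 1 (`infProd_ite_of_infinite`).
open Classical in
theorem infProd_ite {p : ℕ → Prop} (hp : {n | p n}.Finite) (z : ℝ≥0∞) (hz : z ≤ 1) :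
    infProd (fun n => if p n then z else 1) = z ^ {n | p n}.ncard := by
  have hle : ∀ n, (if p n then z else 1) ≤ 1 := fun n => by split_ifs <;> simp [hz]
  refine tendsto_nhds_unique (tendsto_infProd hle) ?_
  obtain ⟨M, hM⟩ := hp.bddAbove
  refine tendsto_const_nhds.congr' ?_
  filter_upwards [eventually_gt_atTop M] with N hN
  rw [Finset.prod_ite, Finset.prod_const, Finset.prod_const_one, mul_one]
  congr 1
  rw [Set.ncard_eq_toFinset_card _ hp]
  congr 1
  ext n
  simp only [Finite.mem_toFinset, mem_ofPred_eq, Finset.mem_filter, Finset.mem_range]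
  exact ⟨fun h => ⟨(hM h).trans_lt hN, h⟩, fun h => h.2⟩

theorem measurable_infProd {X : Type*} [MeasurableSpace X] {h : ℕ → X → ℝ≥0∞}
    (hm : ∀ n, Measurable (h n)) : Measurable (fun x => infProd (fun n => h n x)) :=
  Measurable.iInf fun _ => Finset.measurable_fun_prod _ fun n _ => hm n

theorem lintegral_infProd {X : Type*} [MeasurableSpace X] (μ : Measure X) [IsFiniteMeasure μ]
    {h : ℕ → X → ℝ≥0∞} (hm : ∀ n, Measurable (h n)) (h1 : ∀ n x, h n x ≤ 1) :
    ∫⁻ x, infProd (fun n => h n x) ∂μ = ⨅ N, ∫⁻ x, ∏ n ∈ Finset.range N, h n x ∂μ := by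
  unfold infProd
  refine lintegral_iInf (fun _ => Finset.measurable_fun_prod _ fun n _ => hm n)
    (fun N M hNM x => antitone_partialProd (fun n => h1 n x) hNM) ?_
  simp

/-! ### Generating function of a Poisson count -/

theorem poisson_tsum (a z : ℝ) (ha : 0 ≤ a) (hz : 0 ≤ z) :
    ∑' k : ℕ, ENNReal.ofReal (Real.exp (-a) * a ^ k / (k.factorial : ℝ)) * ENNReal.ofReal z ^ k =
      ENNReal.ofReal (Real.exp (-(a * (1 - z)))) := by
  have hs : HasSum (fun k : ℕ => Real.exp (-a) * a ^ k / (k.factorial : ℝ) * z ^ k)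
      (Real.exp (-(a * (1 - z)))) := by
    have := (NormedSpace.expSeries_div_hasSum_exp (a * z)).mul_left (Real.exp (-a))
    rw [← Real.exp_eq_exp_ℝ, ← Real.exp_add] at this
    rw [show -(a * (1 - z)) = -a + a * z by ring]
    refine this.congr_fun fun k => ?_
    rw [mul_pow]; ring
  rw [← hs.tsum_eq, ENNReal.ofReal_tsum_of_nonneg (fun k => by positivity) hs.summable]
  congr 1 with k
  rw [ENNReal.ofReal_mul (by positivity), ENNReal.ofReal_pow hz]

/-- The Poisson weights of the finite values already sum to 1 (generating function at z = 1), which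
leaves no mass for ⊤. -/
theorem ae_ne_top_of_poisson {Ω : Type*} [MeasurableSpace Ω] (μ : Measure Ω)
    [IsProbabilityMeasure μ] {K : Ω → ℕ∞} (hK : Measurable K) {a : ℝ} (ha : 0 ≤ a)
    (h : ∀ k : ℕ, μ.real {ω | K ω = k} = Real.exp (-a) * a ^ k / (k.factorial : ℝ)) :
    ∀ᵐ ω ∂μ, K ω ≠ ⊤ := by
  have hms : ∀ k : ℕ, MeasurableSet {ω | K ω = k} := fun k => hK (measurableSet_singleton _)
  have hU : μ (⋃ k : ℕ, {ω | K ω = k}) = 1 := by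
    rw [measure_iUnion (fun i j hij => ?_) hms]
    · have := poisson_tsum a 1 ha zero_le_one
      simp only [ENNReal.ofReal_one, one_pow, mul_one, sub_self, mul_zero, neg_zero,
        Real.exp_zero] at this
      rw [← this]
      congr 1 with k
      rw [← h, ofReal_measureReal]
    · refine Set.disjoint_left.2 fun ω h1 h2 => hij ?_
      simp only [mem_ofPred_eq] at h1 h2
      rw [h1] at h2
      exact_mod_cast h2
  have := (prob_compl_eq_zero_iff (MeasurableSet.iUnion hms)).2 hU
  filter_upwards [compl_mem_ae_iff.2 this] with ω hω hT
  simp [hT] at hω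

/-- `toNat` sends ⊤ to 0; this value is harmless because the event is null. -/
theorem lintegral_pow_of_poisson {Ω : Type*} [MeasurableSpace Ω] (μ : Measure Ω)
    [IsProbabilityMeasure μ] {K : Ω → ℕ∞} (hK : Measurable K) {a : ℝ} (ha : 0 ≤ a)
    (h : ∀ k : ℕ, μ.real {ω | K ω = k} = Real.exp (-a) * a ^ k / (k.factorial : ℝ))
    {z : ℝ} (hz : 0 ≤ z) :
    ∫⁻ ω, ENNReal.ofReal z ^ (K ω).toNat ∂μ = ENNReal.ofReal (Real.exp (-(a * (1 - z)))) := by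
  have hms : ∀ k : ℕ, MeasurableSet {ω | K ω = k} := fun k => hK (measurableSet_singleton _)
  have hU : (⋃ k : ℕ, {ω | K ω = k}) =ᵐ[μ] univ := by
    rw [eventuallyEq_univ]
    filter_upwards [ae_ne_top_of_poisson μ hK ha h] with ω hω
    obtain ⟨k, hk⟩ := ENat.ne_top_iff_exists.1 hω
    exact mem_iUnion.2 ⟨k, hk.symm⟩
  rw [← setLIntegral_univ, ← setLIntegral_congr hU, lintegral_iUnion hms, ← poisson_tsum a z ha hz]
  · congr 1 with k
    rw [setLIntegral_congr_fun (g := fun _ => ENNReal.ofReal z ^ k) (hms k)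
      (fun ω hω => by simp only [mem_ofPred_eq] at hω; simp [hω]), setLIntegral_const, ← h,
      ofReal_measureReal, mul_comm]
  · refine fun i j hij => Set.disjoint_left.2 fun ω h1 h2 => hij ?_
    simp only [mem_ofPred_eq] at h1 h2
    rw [h1] at h2
    exact_mod_cast h2

theorem measurable_encard_setOf {X : Type*} [MeasurableSpace X] {p : ℕ → X → Prop}
    (hp : ∀ n, MeasurableSet {x | p n x}) : Measurable (fun x => {n | p n x}.encard) :=
  measurable_encard.comp (measurable_set_iff.2 fun n => measurableSet_setOfPred.1 (hp n))

/-! ### Generating functional of the Poisson process -/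

namespace IsHomogeneousPoissonProcess

variable {Ω : Type*} [MeasurableSpace Ω] {μ : Measure Ω} {lam : ℝ}
  {T : ℕ → Ω → Plane}

theorem measurable_pointCount (hT : IsHomogeneousPoissonProcess μ lam T) {B : Set Plane}
    (hB : MeasurableSet B) : Measurable (pointCount T B) :=
  measurable_encard_setOf fun n => hT.measurable_point n hB

theorem iIndepFun_pointCount (hT : IsHomogeneousPoissonProcess μ lam T) {ι : Type*} [Fintype ι]
    {B : ι → Set Plane} (hB : ∀ i, MeasurableSet (B i))
    (hd : Pairwise (Function.onFun Disjoint B)) : iIndepFun (fun i => pointCount T (B i)) μ := by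
  let e := Fintype.equivFin ι
  have h := hT.count_indep (Fintype.card ι) (fun j => B (e.symm j)) (fun j => hB _)
    (hd.comp_of_injective e.symm.injective)
  have := h.precomp (g := e) e.injective
  simpa using this

-- For a step function the product over the points regroups as ∏ z_i ^ (number of points in B_i);
-- independence of the counts and the Poisson generating function finish.
open Classical in
theorem lintegral_infProd_of_pairwise_disjoint [IsProbabilityMeasure μ]
    (hT : IsHomogeneousPoissonProcess μ lam T)
    (hlam : 0 ≤ lam) {ι : Type*} [Fintype ι] {B : ι → Set Plane} (hB : ∀ i, MeasurableSet (B i))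
    (hd : Pairwise (Function.onFun Disjoint B)) (hv : ∀ i, volume (B i) < ⊤) {z : ι → ℝ}
    (hz0 : ∀ i, 0 ≤ z i) (hz1 : ∀ i, z i ≤ 1) :
    ∫⁻ ω, infProd (fun n => ∏ i, if T n ω ∈ B i then ENNReal.ofReal (z i) else 1) ∂μ =
      ENNReal.ofReal (Real.exp (-(lam * ∑ i, (1 - z i) * volume.real (B i)))) := by
  have hz1' : ∀ i, ENNReal.ofReal (z i) ≤ 1 := fun i => by simpa using hz1 i
  have ha : ∀ i, 0 ≤ lam * volume.real (B i) := fun i => by positivity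
  have hae : ∀ᵐ ω ∂μ, ∀ i, pointCount T (B i) ω ≠ ⊤ := by
    rw [ae_all_iff]
    exact fun i => ae_ne_top_of_poisson μ (hT.measurable_pointCount (hB i)) (ha i)
      (hT.count_poisson (B i) (hB i) (hv i))
  have hm : ∀ i, Measurable fun n : ℕ∞ => ENNReal.ofReal (z i) ^ n.toNat :=
    fun i => Measurable.of_discrete
  calc _ = ∫⁻ ω, ∏ i, ENNReal.ofReal (z i) ^ (pointCount T (B i) ω).toNat ∂μ := by
        refine lintegral_congr_ae ?_
        filter_upwards [hae] with ω hω
        rw [infProd_finset_prod _ fun i n => by split_ifs <;> simp [hz1 i]]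
        refine Finset.prod_congr rfl fun i _ => ?_
        rw [infProd_ite (Set.encard_ne_top_iff.1 (hω i)) _ (hz1' i)]
        rfl
    _ = ∏ i, ∫⁻ ω, ENNReal.ofReal (z i) ^ (pointCount T (B i) ω).toNat ∂μ := by
        have hind := (hT.iIndepFun_pointCount hB hd).comp
          (fun i (n : ℕ∞) => ENNReal.ofReal (z i) ^ n.toNat) hm
        exact lintegral_prod_eq_prod_lintegral_of_indepFun Finset.univ _ hind
          fun i => (hm i).comp (hT.measurable_pointCount (hB i))
    _ = ∏ i, ENNReal.ofReal (Real.exp (-(lam * volume.real (B i) * (1 - z i)))) :=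
        Finset.prod_congr rfl fun i _ => lintegral_pow_of_poisson μ
          (hT.measurable_pointCount (hB i)) (ha i)
          (hT.count_poisson (B i) (hB i) (hv i)) (hz0 i)
    _ = _ := by
        rw [← ENNReal.ofReal_prod_of_nonneg fun i _ => (Real.exp_pos _).le, ← Real.exp_sum]
        congr 2
        rw [Finset.sum_neg_distrib, Finset.mul_sum]
        congr 1
        exact Finset.sum_congr rfl fun i _ => by ring

/-- The disjoint sets are the fibres of u over its nonzero values v, with weight z = 1 - v. Fibres
over nonzero values have finite area; the fibre over 0 contributes factors 1. -/
theorem lintegral_infProd_simpleFunc [IsProbabilityMeasure μ]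
    (hT : IsHomogeneousPoissonProcess μ lam T)
    (hlam : 0 ≤ lam) (u : SimpleFunc Plane ℝ≥0∞) (hu : ∀ x, u x ≤ 1)
    (hf : volume {x | u x ≠ 0} < ⊤) :
    ∫⁻ ω, infProd (fun n => 1 - u (T n ω)) ∂μ =
      ENNReal.ofReal (Real.exp (-(lam * (∫⁻ x, u x).toReal))) := by
  classical
  let s := u.range.filter (· ≠ 0)
  have hs1 : ∀ v : s, (v : ℝ≥0∞) ≤ 1 := by
    rintro ⟨v, hv⟩
    obtain ⟨x, rfl⟩ := SimpleFunc.mem_range.1 (Finset.mem_filter.1 hv).1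
    exact hu x
  have hs0 : ∀ v : s, (v : ℝ≥0∞) ≠ 0 := fun v => (Finset.mem_filter.1 v.2).2
  have hst : ∀ v : s, (v : ℝ≥0∞) ≠ ⊤ := fun v => ((hs1 v).trans_lt ENNReal.one_lt_top).ne
  have hvol : ∀ v : s, volume (u ⁻¹' {(v : ℝ≥0∞)}) < ⊤ := fun v =>
    (measure_mono fun x hx => by
      have hx' : u x = v := hx
      simpa [hx'] using hs0 v).trans_lt hf
  have key := hT.lintegral_infProd_of_pairwise_disjoint hlam
    (B := fun v : s => u ⁻¹' {(v : ℝ≥0∞)}) (fun v => u.measurableSet_fiber _)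
    (fun v w hvw => by
      refine Set.disjoint_left.2 fun x h1 h2 => hvw (Subtype.ext ?_)
      have h1' : u x = v := h1
      have h2' : u x = w := h2
      rw [← h1', ← h2']) hvol
    (z := fun v => 1 - (v : ℝ≥0∞).toReal)
    (fun v => by
      have := ENNReal.toReal_mono ENNReal.one_ne_top (hs1 v)
      simp only [ENNReal.toReal_one] at this
      linarith)
    (fun v => by have := ENNReal.toReal_nonneg (a := (v : ℝ≥0∞)); linarith)
  have hofR : ∀ v : s, ENNReal.ofReal (1 - (v : ℝ≥0∞).toReal) = 1 - v := fun v => by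
    rw [ENNReal.ofReal_sub _ ENNReal.toReal_nonneg, ENNReal.ofReal_one,
      ENNReal.ofReal_toReal (hst v)]
  have hfac : ∀ x, (∏ v : s, if x ∈ u ⁻¹' {(v : ℝ≥0∞)} then
      ENNReal.ofReal (1 - (v : ℝ≥0∞).toReal) else 1) = 1 - u x := by
    intro x
    simp_rw [hofR]
    rw [Finset.prod_coe_sort s (fun v => if x ∈ u ⁻¹' {v} then 1 - v else 1)]
    by_cases hx : u x = 0
    · rw [Finset.prod_eq_one, hx, tsub_zero]
      intro v hv
      rw [if_neg]
      intro h
      have h' : u x = v := h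
      exact (Finset.mem_filter.1 hv).2 (h' ▸ hx)
    · rw [Finset.prod_eq_single_of_mem (u x)
        (Finset.mem_filter.2 ⟨u.mem_range_self x, hx⟩)]
      · simp
      · intro v _ hv
        rw [if_neg]
        intro h
        exact hv (show u x = v from h).symm
  have hint : (∫⁻ x, u x).toReal =
      ∑ v : s, (1 - (1 - (v : ℝ≥0∞).toReal)) * volume.real (u ⁻¹' {(v : ℝ≥0∞)}) := by
    rw [u.lintegral_eq_lintegral, SimpleFunc.lintegral,
      ← Finset.sum_subset (Finset.filter_subset (· ≠ 0) u.range), ← Finset.sum_coe_sort,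
      ENNReal.toReal_sum]
    · refine Finset.sum_congr rfl fun v _ => ?_
      rw [ENNReal.toReal_mul, sub_sub_cancel, Measure.real]
    · exact fun v _ => ENNReal.mul_ne_top (hst v) (hvol v).ne
    · intro v hv hv'
      have : v = 0 := by
        by_contra h
        exact hv' (Finset.mem_filter.2 ⟨hv, h⟩)
      simp [this]
  simp_rw [hfac] at key
  rw [key, hint]

/-- The probability generating functional of a homogeneous Poisson process. -/
theorem lintegral_infProd [IsProbabilityMeasure μ]
    (hT : IsHomogeneousPoissonProcess μ lam T)
    (hlam : 0 ≤ lam) {u : Plane → ℝ≥0∞} (hum : Measurable u) (hu : ∀ x, u x ≤ 1)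
    (hf : ∫⁻ x, u x ≠ ⊤) :
    ∫⁻ ω, infProd (fun n => 1 - u (T n ω)) ∂μ =
      ENNReal.ofReal (Real.exp (-(lam * (∫⁻ x, u x).toReal))) := by
  -- Restricting the simple approximations to growing balls makes their supports of finite area
  -- while keeping the sequence monotone with supremum u.
  let w : ℕ → SimpleFunc Plane ℝ≥0∞ := fun k =>
    (SimpleFunc.eapprox u k).restrict (Metric.closedBall 0 k)
  have hw : ∀ k x, w k x = (Metric.closedBall (0 : Plane) k).indicator
      (SimpleFunc.eapprox u k) x := fun k x =>
    SimpleFunc.restrict_apply _ Metric.isClosed_closedBall.measurableSet x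
  have hle : ∀ k x, w k x ≤ u x := fun k x => by
    rw [hw, ← SimpleFunc.iSup_eapprox_apply hum x]
    exact (Set.indicator_le_self _ _ _).trans (le_iSup (fun k => SimpleFunc.eapprox u k x) k)
  have hmono : ∀ x, Monotone fun k => w k x := fun x k l hkl => by
    simp only [hw]
    refine (Set.indicator_le_indicator (SimpleFunc.monotone_eapprox u hkl x)).trans
      (Set.indicator_le_indicator_of_subset
        (Metric.closedBall_subset_closedBall (by exact_mod_cast hkl)) (fun _ => zero_le) x)
  have hsup : ∀ x, ⨆ k, w k x = u x := fun x => by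
    refine le_antisymm (iSup_le fun k => hle k x) ?_
    rw [← SimpleFunc.iSup_eapprox_apply hum x]
    refine iSup_le fun k => ?_
    obtain ⟨m, hm⟩ := exists_nat_ge ‖x‖
    refine le_iSup_of_le (max k m) ?_
    rw [hw, Set.indicator_of_mem (by
      rw [mem_closedBall_zero_iff]; exact hm.trans (by exact_mod_cast le_max_right k m))]
    exact SimpleFunc.monotone_eapprox u (le_max_left k m) x
  have hkey : ∀ k, ∫⁻ ω, infProd (fun n => 1 - w k (T n ω)) ∂μ =
      ENNReal.ofReal (Real.exp (-(lam * (∫⁻ x, w k x).toReal))) := fun k => by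
    refine hT.lintegral_infProd_simpleFunc hlam (w k) (fun x => (hle k x).trans (hu x)) ?_
    refine (measure_mono fun x hx => ?_).trans_lt
      (measure_closedBall_lt_top (x := (0 : Plane)) (r := k))
    rw [mem_ofPred_eq, hw] at hx
    exact Set.mem_of_indicator_ne_zero hx
  have hlim1 : Tendsto (fun k => ∫⁻ ω, infProd (fun n => 1 - w k (T n ω)) ∂μ) atTop
      (𝓝 (∫⁻ ω, infProd (fun n => 1 - u (T n ω)) ∂μ)) := by
    -- As w k increases, the products decrease, and they are bounded by 1, so monotone convergence
    -- applies from above.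
    have hanti : Antitone fun k => fun ω => infProd (fun n => 1 - w k (T n ω)) :=
      fun k l hkl ω => iInf_mono fun N => Finset.prod_le_prod' fun n _ =>
        tsub_le_tsub_left (hmono _ hkl) _
    have : ∫⁻ ω, infProd (fun n => 1 - u (T n ω)) ∂μ =
        ⨅ k, ∫⁻ ω, infProd (fun n => 1 - w k (T n ω)) ∂μ := by
      rw [← lintegral_iInf (f := fun k ω => infProd (fun n => 1 - w k (T n ω)))
        (fun k => measurable_infProd fun n => measurable_const.sub
        ((w k).measurable.comp (hT.measurable_point n))) hanti]
      · refine lintegral_congr fun ω => ?_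
        rw [← infProd_iInf (h := fun k n => 1 - w k (T n ω)) (fun k n => tsub_le_self)
          (fun n k l hkl => tsub_le_tsub_left (hmono _ hkl) _)]
        congr 1 with n
        rw [← ENNReal.sub_iSup ENNReal.one_ne_top, hsup]
      · rw [hkey]; exact ENNReal.ofReal_ne_top
    rw [this]
    exact tendsto_atTop_iInf fun k l hkl => lintegral_mono (hanti hkl)
  have hlim2 : Tendsto (fun k => ∫⁻ x, w k x) atTop (𝓝 (∫⁻ x, u x)) := by
    simp_rw [← hsup]
    rw [lintegral_iSup (fun k => (w k).measurable) fun k l hkl x => hmono x hkl]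
    exact tendsto_atTop_iSup fun k l hkl => lintegral_mono fun x => hmono x hkl
  refine tendsto_nhds_unique hlim1 ?_
  simp_rw [hkey]
  refine (ENNReal.continuous_ofReal.tendsto _).comp ((Real.continuous_exp.tendsto _).comp ?_)
  exact (((ENNReal.tendsto_toReal hf).comp hlim2).const_mul lam).neg

end IsHomogeneousPoissonProcess

/-! ### Independent marking -/

namespace IsInterfererField

variable {Ω : Type*} [MeasurableSpace Ω] {μ : Measure Ω} {lam : ℝ}
  {T : ℕ → Ω → Plane} {ρ : ℕ → Ω → ℝ}

instance : IsProbabilityMeasure (expMeasure 1) := isProbabilityMeasure_expMeasure one_pos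

/-- With the positions frozen, independence of the fading variables splits the expectation of the
product; independence of positions and fading allows the positions to be frozen. -/
theorem lintegral_finset_prod_marks [IsProbabilityMeasure μ] (h : IsInterfererField μ lam T ρ)
    {k : Plane × ℝ → ℝ≥0∞} (hk : Measurable k) (s : Finset ℕ) :
    ∫⁻ ω, ∏ n ∈ s, k (T n ω, ρ n ω) ∂μ =
      ∫⁻ ω, ∏ n ∈ s, ∫⁻ r, k (T n ω, r) ∂(expMeasure 1) ∂μ := by
  have hTm : Measurable fun ω n => T n ω := measurable_pi_lambda _ h.poisson.measurable_point
  have hρm : Measurable fun ω n => ρ n ω := measurable_pi_lambda _ h.measurable_fading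
  have hpair := (indepFun_iff_map_prod_eq_prod_map_map hTm.aemeasurable hρm.aemeasurable).1
    h.points_indep_fading
  have hF : Measurable fun p : (ℕ → Plane) × (ℕ → ℝ) => ∏ n ∈ s, k (p.1 n, p.2 n) := by
    refine Finset.measurable_fun_prod _ fun n _ => hk.comp ?_
    fun_prop
  have hG : Measurable fun t : Plane => ∫⁻ r, k (t, r) ∂(expMeasure 1) := hk.lintegral_prod_right'
  have hinner : ∀ t : ℕ → Plane, ∫⁻ ω, ∏ n ∈ s, k (t n, ρ n ω) ∂μ =
      ∏ n ∈ s, ∫⁻ r, k (t n, r) ∂(expMeasure 1) := by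
    intro t
    have hkm : ∀ n, Measurable fun r => k (t n, r) := fun n => hk.comp measurable_prodMk_left
    have hind := h.fading_indep.comp (fun n r => k (t n, r)) hkm
    refine (lintegral_prod_eq_prod_lintegral_of_indepFun s _ hind
      fun n => (hkm n).comp (h.measurable_fading n)).trans ?_
    refine Finset.prod_congr rfl fun n _ => ?_
    rw [← h.fading_law n, lintegral_map (hkm n) (h.measurable_fading n)]
    rfl
  have : IsProbabilityMeasure (μ.map fun ω n => ρ n ω) :=
    Measure.isProbabilityMeasure_map hρm.aemeasurable
  calc ∫⁻ ω, ∏ n ∈ s, k (T n ω, ρ n ω) ∂μ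
      = ∫⁻ p, ∏ n ∈ s, k (p.1 n, p.2 n) ∂(μ.map fun ω => (fun n => T n ω, fun n => ρ n ω)) := by
        rw [lintegral_map hF (hTm.prodMk hρm)]
    _ = ∫⁻ t, ∫⁻ ω, ∏ n ∈ s, k (t n, ρ n ω) ∂μ ∂(μ.map fun ω n => T n ω) := by
        rw [hpair, lintegral_prod _ hF.aemeasurable]
        refine lintegral_congr fun t => ?_
        exact lintegral_map (hF.comp measurable_prodMk_left) hρm
    _ = ∫⁻ t, ∏ n ∈ s, ∫⁻ r, k (t n, r) ∂(expMeasure 1) ∂(μ.map fun ω n => T n ω) :=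
        lintegral_congr hinner
    _ = _ := by
        rw [lintegral_map _ hTm]
        exact Finset.measurable_fun_prod _ fun n _ => hG.comp (measurable_pi_apply n)

/-- The probability generating functional of the marked process. -/
theorem lintegral_infProd_marks [IsProbabilityMeasure μ] (h : IsInterfererField μ lam T ρ)
    (hlam : 0 ≤ lam) {v : Plane × ℝ → ℝ≥0∞} (hv : Measurable v) (hv1 : ∀ x, v x ≤ 1)
    (hf : ∫⁻ x, v x ∂(volume.prod (expMeasure 1)) ≠ ⊤) :
    ∫⁻ ω, infProd (fun n => 1 - v (T n ω, ρ n ω)) ∂μ =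
      ENNReal.ofReal (Real.exp (-(lam *
        (∫⁻ x, v x ∂(volume.prod (expMeasure 1))).toReal))) := by
  have hG : Measurable fun t : Plane => ∫⁻ r, v (t, r) ∂(expMeasure 1) := hv.lintegral_prod_right'
  have hG1 : ∀ t : Plane, ∫⁻ r, v (t, r) ∂(expMeasure 1) ≤ 1 := fun t =>
    (lintegral_mono fun r => hv1 (t, r)).trans (by simp)
  have hsub : ∀ t : Plane, ∫⁻ r, 1 - v (t, r) ∂(expMeasure 1) =
      1 - ∫⁻ r, v (t, r) ∂(expMeasure 1) := fun t => by
    rw [lintegral_sub (g := fun r => v (t, r)) (hv.comp measurable_prodMk_left)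
      ((hG1 t).trans_lt ENNReal.one_lt_top).ne (ae_of_all _ fun r => hv1 _)]
    simp
  have hvm : ∀ n, Measurable fun ω => 1 - v (T n ω, ρ n ω) := fun n => measurable_const.sub
    (hv.comp ((h.poisson.measurable_point n).prodMk (h.measurable_fading n)))
  have hGm : ∀ n, Measurable fun ω => 1 - ∫⁻ r, v (T n ω, r) ∂(expMeasure 1) := fun n =>
    measurable_const.sub (hG.comp (h.poisson.measurable_point n))
  -- Averaging over a mark turns the factor 1 - v(t, r) into 1 - ∫ v(t, r) dr-law, so the marked
  -- functional is the unmarked one of the averaged v. The comparison is made on finite partial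
  -- products.
  rw [lintegral_prod _ hv.aemeasurable] at hf ⊢
  rw [← h.poisson.lintegral_infProd hlam hG hG1 hf,
    lintegral_infProd μ hvm (fun _ _ => tsub_le_self),
    lintegral_infProd μ hGm (fun _ _ => tsub_le_self)]
  congr 1 with N
  rw [h.lintegral_finset_prod_marks (k := fun x => 1 - v x) (measurable_const.sub hv)]
  simp_rw [hsub]

end IsInterfererField

/-! ### Intensity of the interference powers -/

/-- The intensity measure of the point process of the interference powers. -/
noncomputable def powerIntensity (α lam : ℝ) : Measure ℝ :=
  ENNReal.ofReal lam • ((volume : Measure Plane).prod (expMeasure 1)).map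
    (fun x : Plane × ℝ => ‖x.1‖ ^ (-α) * x.2)

theorem measurable_power (α : ℝ) :
    Measurable fun x : Plane × ℝ => ‖x.1‖ ^ (-α) * x.2 := by
  fun_prop

theorem measurable_interferencePower {Ω : Type*} [MeasurableSpace Ω] {α : ℝ}
    {T : ℕ → Ω → Plane} {ρ : ℕ → Ω → ℝ} (hT : ∀ n, Measurable (T n))
    (hρ : ∀ n, Measurable (ρ n)) (n : ℕ) : Measurable (interferencePower α T ρ n) :=
  ((hT n).norm.pow_const (-α)).mul (hρ n)

/-- The probability generating functional of the process of interference powers. -/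
theorem IsInterfererField.lintegral_infProd_power {Ω : Type*} [MeasurableSpace Ω] {μ : Measure Ω}
    [IsProbabilityMeasure μ] {lam : ℝ} {T : ℕ → Ω → Plane} {ρ : ℕ → Ω → ℝ}
    (h : IsInterfererField μ lam T ρ) (α : ℝ) (hlam : 0 < lam) {v : ℝ → ℝ≥0∞}
    (hv : Measurable v) (hv1 : ∀ x, v x ≤ 1) (hf : ∫⁻ x, v x ∂(powerIntensity α lam) ≠ ⊤) :
    ∫⁻ ω, infProd (fun n => 1 - v (interferencePower α T ρ n ω)) ∂μ =
      ENNReal.ofReal (Real.exp (-(∫⁻ x, v x ∂(powerIntensity α lam)).toReal)) := by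
  have hl : ENNReal.ofReal lam ≠ 0 := by simpa using hlam
  rw [powerIntensity, lintegral_smul_measure, lintegral_map hv (measurable_power α),
    smul_eq_mul] at hf ⊢
  have hf' : ∫⁻ x : Plane × ℝ, v (‖x.1‖ ^ (-α) * x.2) ∂(volume.prod (expMeasure 1)) ≠ ⊤ :=
    fun hc => hf (by rw [hc, ENNReal.mul_top hl])
  rw [ENNReal.toReal_mul, ENNReal.toReal_ofReal hlam.le]
  exact h.lintegral_infProd_marks (v := fun x => v (‖x.1‖ ^ (-α) * x.2)) hlam.le
    (hv.comp (measurable_power α)) (fun x => hv1 _) hf'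

theorem lintegral_expMeasure_one (F : ℝ → ℝ≥0∞) (hF : Measurable F) :
    ∫⁻ r, F r ∂(expMeasure 1) = ∫⁻ r in Ioi 0, ENNReal.ofReal (Real.exp (-r)) * F r := by
  rw [expMeasure, gammaMeasure, lintegral_withDensity_eq_lintegral_mul _
    (f := gammaPDF 1 1) (measurable_gammaPDFReal 1 1).ennreal_ofReal hF,
    ← lintegral_indicator measurableSet_Ioi]
  refine lintegral_congr_ae ?_
  filter_upwards [Measure.ae_ne volume (0 : ℝ)] with r hr
  rcases lt_or_gt_of_ne hr with h | h
  · rw [indicator_of_notMem (by simpa using h.le), Pi.mul_apply, gammaPDF_of_neg h, zero_mul]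
  · rw [indicator_of_mem (by simpa using h), Pi.mul_apply, gammaPDF_of_nonneg h.le]
    simp

theorem lintegral_rpow_expMeasure_one {d : ℝ} (hd : 0 < d) :
    ∫⁻ r, ENNReal.ofReal (r ^ d) ∂(expMeasure 1) = ENNReal.ofReal (Real.Gamma (d + 1)) := by
  rw [lintegral_expMeasure_one _ (by fun_prop), Real.Gamma_eq_integral (by linarith),
    ofReal_integral_eq_lintegral_ofReal (Real.GammaIntegral_convergent (by linarith))]
  · refine setLIntegral_congr_fun measurableSet_Ioi fun r hr => ?_
    rw [← ENNReal.ofReal_mul (Real.exp_pos _).le, add_sub_cancel_right]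
  · filter_upwards [ae_restrict_mem measurableSet_Ioi] with r hr
    have : (0 : ℝ) < r := hr
    positivity

theorem ae_expMeasure_one_pos : ∀ᵐ r ∂(expMeasure 1), 0 < r := by
  have h : ∫⁻ r, (Iic (0 : ℝ)).indicator 1 r ∂(expMeasure 1) = 0 := by
    rw [lintegral_expMeasure_one _ (measurable_one.indicator measurableSet_Iic),
      setLIntegral_congr_fun (g := fun _ => 0) measurableSet_Ioi, lintegral_zero]
    intro r hr
    simp [show 0 < r from hr]
  rw [lintegral_indicator_one measurableSet_Iic] at h
  rw [ae_iff]
  convert h using 2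
  ext r
  simp

theorem volume_power_gt {α : ℝ} (hα : 0 < α) {x r : ℝ} (hx : 0 < x) (hr : 0 < r) :
    volume {t : Plane | x < ‖t‖ ^ (-α) * r} =
      ENNReal.ofReal (Real.pi * x ^ (-(2 / α)) * r ^ (2 / α)) := by
  -- The origin is removed because `0 ^ (-α) = 0` for the real power, so a node located there would
  -- have power 0.
  have : {t : Plane | x < ‖t‖ ^ (-α) * r} =
      Metric.ball (0 : Plane) ((r / x) ^ (1 / α)) \ {0} := by
    ext t
    simp only [mem_ofPred_eq, Set.mem_sdiff, mem_ball_zero_iff, mem_singleton_iff]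
    rcases eq_or_ne t 0 with rfl | ht
    · simp [Real.zero_rpow (neg_ne_zero.2 hα.ne'), hx.le]
    · have ht' : 0 < ‖t‖ := norm_pos_iff.2 ht
      simp only [ht, not_false_eq_true, and_true]
      rw [Real.rpow_neg ht'.le, inv_mul_eq_div, lt_div_iff₀ (by positivity), ← lt_div_iff₀' hx,
        one_div, Real.lt_rpow_inv_iff_of_pos ht'.le (by positivity) hα]
  rw [this, measure_sdiff_null (measure_singleton _), EuclideanSpace.volume_ball_fin_two,
    ← ENNReal.ofReal_pow (by positivity), ← ENNReal.ofReal_mul (by positivity)]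
  congr 1
  rw [← Real.rpow_natCast, ← Real.rpow_mul (by positivity), Real.div_rpow hr.le hx.le,
    Real.rpow_neg hx.le]
  push_cast
  rw [show 1 / α * 2 = 2 / α by ring]
  field_simp

/-- The tail of the intensity of the interference powers. -/
theorem powerIntensity_Ioi {α lam : ℝ} (hα : 0 < α) (hlam : 0 < lam) {x : ℝ} (hx : 0 < x) :
    powerIntensity α lam (Ioi x) =
      ENNReal.ofReal (Real.pi * Real.Gamma (2 / α + 1) * lam * x ^ (-(2 / α))) := by
  rw [powerIntensity, Measure.smul_apply, Measure.map_apply (measurable_power α) measurableSet_Ioi,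
    Measure.prod_apply_symm (measurable_power α measurableSet_Ioi), smul_eq_mul]
  -- The fading is the outer variable: each section has area π x^(-δ) r^δ, and the average of r^δ is
  -- Γ(δ+1).
  have : ∫⁻ r, volume ((fun t : Plane => (t, r)) ⁻¹'
      ((fun x : Plane × ℝ => ‖x.1‖ ^ (-α) * x.2) ⁻¹' Ioi x)) ∂(expMeasure 1) =
      ∫⁻ r, ENNReal.ofReal (Real.pi * x ^ (-(2 / α))) * ENNReal.ofReal (r ^ (2 / α))
        ∂(expMeasure 1) := by
    refine lintegral_congr_ae ?_
    filter_upwards [ae_expMeasure_one_pos] with r hr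
    rw [← ENNReal.ofReal_mul (by positivity), ← volume_power_gt hα hx hr]
    rfl
  rw [this, lintegral_const_mul _ (by fun_prop), lintegral_rpow_expMeasure_one (by positivity),
    ← ENNReal.ofReal_mul (by positivity), ← ENNReal.ofReal_mul hlam.le]
  congr 1
  ring

theorem powerIntensity_Ioc {α lam : ℝ} (hα : 0 < α) (hlam : 0 < lam) {x g : ℝ} (hx : 0 < x)
    (hxg : x ≤ g) :
    powerIntensity α lam (Ioc x g) = ENNReal.ofReal (Real.pi * Real.Gamma (2 / α + 1) * lam *
      (x ^ (-(2 / α)) - g ^ (-(2 / α)))) := by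
  rw [← Ioi_sdiff_Ioi, measure_sdiff (Ioi_subset_Ioi hxg) measurableSet_Ioi.nullMeasurableSet,
    powerIntensity_Ioi hα hlam hx, powerIntensity_Ioi hα hlam (hx.trans_le hxg),
    ← ENNReal.ofReal_sub _ ?_, mul_sub]
  · have := Real.Gamma_pos_of_pos (s := 2 / α + 1) (by positivity)
    have := hx.trans_le hxg
    positivity
  · rw [powerIntensity_Ioi hα hlam (hx.trans_le hxg)]
    exact ENNReal.ofReal_ne_top

/-- Truncated moments of the intensity of the interference powers. -/
theorem lintegral_rpow_powerIntensity {α lam : ℝ} (hα : 0 < α) (hlam : 0 < lam) {g p : ℝ}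
    (hg : 0 < g) (hp : 1 ≤ p) (hαp : 2 / α < 1) :
    ∫⁻ y in Ioc 0 g, ENNReal.ofReal (y ^ p) ∂(powerIntensity α lam) =
      ENNReal.ofReal (Real.pi * Real.Gamma (2 / α + 1) * lam * ((2 / α) / (p - 2 / α)) *
        g ^ (p - 2 / α)) := by
  set c := Real.pi * Real.Gamma (2 / α + 1) * lam with hc
  have hδ : 0 < 2 / α := by positivity
  generalize hδdef : 2 / α = δ at *
  have hc0 : 0 ≤ c := by
    have := Real.Gamma_pos_of_pos (s := δ + 1) (by linarith)
    positivity
  have hp0 : 0 < p := by linarith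
  -- Layer-cake formula: ∫ y^p dΛ = p ∫ t^(p-1) Λ((t, g]) dt with Λ((t, g]) = c (t^(-δ) - g^(-δ)).
  rw [lintegral_rpow_eq_lintegral_meas_lt_mul _ _ aemeasurable_id' hp0]
  swap
  · filter_upwards [ae_restrict_mem measurableSet_Ioc] with y hy using hy.1.le
  have h1 : ∫⁻ t in Ioi 0, (powerIntensity α lam).restrict (Ioc 0 g) {a | t < a} *
      ENNReal.ofReal (t ^ (p - 1)) =
      ∫⁻ t in Ioc 0 g, ENNReal.ofReal (c * (t ^ (p - 1 - δ) - g ^ (-δ) * t ^ (p - 1))) := by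
    have hsub : Ioc 0 g ⊆ Ioi (0 : ℝ) := fun t ht => ht.1
    rw [← lintegral_indicator measurableSet_Ioi, ← lintegral_indicator measurableSet_Ioc]
    refine lintegral_congr fun t => ?_
    by_cases ht0 : 0 < t
    · rw [indicator_of_mem (show t ∈ Ioi 0 from ht0),
        show {a | t < a} = Ioi t from rfl, Measure.restrict_apply measurableSet_Ioi]
      have hset : Ioi t ∩ Ioc 0 g = Ioc t g := by
        ext a
        simp only [mem_inter_iff, mem_Ioi, mem_Ioc]
        exact ⟨fun h => ⟨h.1, h.2.2⟩, fun h => ⟨h.1, ht0.trans h.1, h.2⟩⟩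
      rw [hset]
      by_cases htg : t ≤ g
      · rw [indicator_of_mem (show t ∈ Ioc 0 g from ⟨ht0, htg⟩),
          powerIntensity_Ioc hα hlam ht0 htg, hδdef, ← hc, ← ENNReal.ofReal_mul']
        · congr 1
          rw [show p - 1 - δ = (-δ) + (p - 1) by ring, Real.rpow_add ht0]
          ring
        · positivity
      · rw [indicator_of_notMem (fun h => htg h.2), Ioc_eq_empty (by linarith)]
        simp
    · rw [indicator_of_notMem (show t ∉ Ioi 0 from ht0),
        indicator_of_notMem (fun h => ht0 h.1)]
  -- Since p ≥ 1 > δ, the exponent p - 1 - δ exceeds -1; this is where α > 2 makes the weak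
  -- interferers summable.
  have hi1 : IntervalIntegrable (fun t : ℝ => t ^ (p - 1 - δ)) volume 0 g :=
    intervalIntegral.intervalIntegrable_rpow' (by linarith)
  have hi2 : IntervalIntegrable (fun t : ℝ => g ^ (-δ) * t ^ (p - 1)) volume 0 g :=
    (intervalIntegral.intervalIntegrable_rpow' (by linarith)).const_mul _
  have hint := (hi1.sub hi2).const_mul c
  have h2 : ∫⁻ t in Ioc 0 g, ENNReal.ofReal (c * (t ^ (p - 1 - δ) - g ^ (-δ) * t ^ (p - 1))) =
      ENNReal.ofReal (c * (g ^ (p - δ) / (p - δ) - g ^ (p - δ) / p)) := by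
    rw [← ofReal_integral_eq_lintegral_ofReal
      ((intervalIntegrable_iff_integrableOn_Ioc_of_le hg.le).1 hint)]
    · rw [← intervalIntegral.integral_of_le hg.le, intervalIntegral.integral_const_mul,
        intervalIntegral.integral_sub hi1 hi2, intervalIntegral.integral_const_mul,
        integral_rpow (Or.inl (by linarith)), integral_rpow (Or.inl (by linarith)),
        show p - 1 - δ + 1 = p - δ by ring, sub_add_cancel, Real.zero_rpow (by linarith),
        Real.zero_rpow hp0.ne', sub_zero, sub_zero, ← mul_div_assoc, ← Real.rpow_add hg,
        show -δ + p = p - δ by ring]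
    · filter_upwards [ae_restrict_mem measurableSet_Ioc] with t ht
      have ht0 : 0 < t := ht.1
      refine mul_nonneg hc0 (sub_nonneg.2 ?_)
      rw [show p - 1 - δ = (-δ) + (p - 1) by ring, Real.rpow_add ht0]
      refine mul_le_mul_of_nonneg_right ?_ (by positivity)
      exact Real.rpow_le_rpow_of_nonpos ht0 ht.2 (by linarith)
  rw [h1, h2, ← ENNReal.ofReal_mul hp0.le]
  congr 1
  have : p - δ ≠ 0 := by linarith
  field_simp
  ring

/-! ### Exponentials of sums and uniqueness of power series -/

theorem infProd_ite_of_infinite {p : ℕ → Prop} [DecidablePred p] (hp : {n | p n}.Infinite)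
    (z : ℝ≥0∞) (hz : z < 1) : infProd (fun n => if p n then z else 1) = 0 := by
  have hle : ∀ n, (if p n then z else 1) ≤ 1 := fun n => by split_ifs <;> simp [hz.le]
  have hpow : ∀ m : ℕ, infProd (fun n => if p n then z else 1) ≤ z ^ m := fun m => by
    obtain ⟨s, hs, hm⟩ := hp.exists_subset_card_eq m
    obtain ⟨N, hN⟩ := s.exists_nat_subset_range
    calc infProd (fun n => if p n then z else 1)
        ≤ ∏ n ∈ Finset.range N, if p n then z else 1 := iInf_le _ N
      _ ≤ ∏ n ∈ s, if p n then z else 1 :=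
        Finset.prod_le_prod_of_subset_of_le_one' hN fun n _ _ => hle n
      _ = z ^ m := by
        rw [Finset.prod_congr rfl fun n hn => if_pos (show p n from hs hn), Finset.prod_const, hm]
  exact le_antisymm (ge_of_tendsto' (ENNReal.tendsto_pow_atTop_nhds_zero_iff.2 hz) hpow) zero_le

/-- `exp (-x)` for `x ∈ [0, ∞]`. -/
noncomputable def expNeg (x : ℝ≥0∞) : ℝ≥0∞ := EReal.exp (-(x : EReal))

theorem expNeg_ofReal {x : ℝ} (hx : 0 ≤ x) :
    expNeg (ENNReal.ofReal x) = ENNReal.ofReal (Real.exp (-x)) := by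
  rw [expNeg, EReal.coe_ennreal_ofReal, max_eq_left hx, ← EReal.coe_neg, EReal.exp_coe]

theorem expNeg_zero : expNeg 0 = 1 := by simp [expNeg]

theorem expNeg_top : expNeg ⊤ = 0 := by simp [expNeg]

theorem continuous_expNeg : Continuous expNeg :=
  ENNReal.continuous_exp.comp (continuous_neg.comp continuous_coe_ennreal_ereal)

theorem expNeg_le_one (x : ℝ≥0∞) : expNeg x ≤ 1 := by
  rw [← expNeg_zero]
  exact EReal.exp_monotone (EReal.neg_le_neg_iff.2 (by simpa using EReal.coe_ennreal_nonneg x))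

theorem expNeg_add (x y : ℝ≥0∞) : expNeg (x + y) = expNeg x * expNeg y := by
  induction x with
  | top => simp [expNeg_top]
  | coe x =>
    induction y with
    | top => simp [expNeg_top]
    | coe y =>
      rw [← ENNReal.coe_add, ← ENNReal.ofReal_coe_nnreal, ← ENNReal.ofReal_coe_nnreal,
        ← ENNReal.ofReal_coe_nnreal, expNeg_ofReal (by positivity), expNeg_ofReal (by positivity),
        expNeg_ofReal (by positivity), ← ENNReal.ofReal_mul (by positivity), ← Real.exp_add]
      congr 2
      push_cast
      ring

theorem expNeg_sum {ι : Type*} (s : Finset ι) (y : ι → ℝ≥0∞) :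
    expNeg (∑ i ∈ s, y i) = ∏ i ∈ s, expNeg (y i) := by
  classical
  induction s using Finset.induction_on with
  | empty => simp [expNeg_zero]
  | insert i s hi ih => rw [Finset.sum_insert hi, Finset.prod_insert hi, expNeg_add, ih]

/-- This converts the product in the generating functional into the Laplace transform of a sum. The
sum may be infinite, so the exponential must be continuous on all of [0, ∞]. -/
theorem infProd_expNeg (y : ℕ → ℝ≥0∞) : infProd (fun n => expNeg (y n)) = expNeg (∑' n, y n) := by
  refine tendsto_nhds_unique (tendsto_infProd fun n => expNeg_le_one _) ?_
  simp_rw [← expNeg_sum]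
  exact (continuous_expNeg.tendsto _).comp ENNReal.summable.hasSum.tendsto_sum_nat

/-- A power series with bounded nonnegative coefficients is determined by its values on `(0, 1)`. -/
theorem eq_of_tsum_mul_pow_eq {C : ℝ≥0∞} (hC : C ≠ ⊤) (k : ℕ) : ∀ {a b : ℕ → ℝ≥0∞},
    (∀ j, a j ≤ C) → (∀ j, b j ≤ C) →
    (∀ z : ℝ, 0 < z → z < 1 → ∑' j, a j * ENNReal.ofReal z ^ j = ∑' j, b j * ENNReal.ofReal z ^ j) →
    a k = b k := by
  have hsplit : ∀ (a : ℕ → ℝ≥0∞) (z : ℝ), ∑' j, a j * ENNReal.ofReal z ^ j =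
      a 0 + ENNReal.ofReal z * ∑' j, a (j + 1) * ENNReal.ofReal z ^ j := fun a z => by
    rw [tsum_eq_zero_add' ENNReal.summable, pow_zero, mul_one, ← ENNReal.tsum_mul_left]
    congr 2 with j
    rw [pow_succ]
    ring
  -- The constant coefficient is the limit at 0+: for z < 1/2 the remaining terms are at most z · C
  -- · ∑ 2^(-j) = 2Cz.
  have hlim : ∀ a : ℕ → ℝ≥0∞, (∀ j, a j ≤ C) →
      Tendsto (fun z : ℝ => ∑' j, a j * ENNReal.ofReal z ^ j) (𝓝[>] 0) (𝓝 (a 0)) := by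
    intro a ha
    have hev : ∀ᶠ z : ℝ in 𝓝[>] 0, ∑' j, a j * ENNReal.ofReal z ^ j ≤
        a 0 + ENNReal.ofReal z * (C * 2) := by
      filter_upwards [Ioo_mem_nhdsGT (show (0 : ℝ) < 1 / 2 by norm_num)] with z hz
      rw [hsplit]
      gcongr
      calc ∑' j, a (j + 1) * ENNReal.ofReal z ^ j ≤ ∑' j : ℕ, C * (2⁻¹ : ℝ≥0∞) ^ j := by
            refine ENNReal.tsum_le_tsum fun j => ?_
            gcongr
            · exact ha _
            · rw [← ENNReal.ofReal_ofNat, ← ENNReal.ofReal_inv_of_pos two_pos]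
              exact ENNReal.ofReal_le_ofReal (by linarith [hz.2])
        _ = C * 2 := by
            rw [ENNReal.tsum_mul_left, ENNReal.tsum_geometric, ENNReal.one_sub_inv_two, inv_inv]
    have hup : Tendsto (fun z : ℝ => a 0 + ENNReal.ofReal z * (C * 2)) (𝓝[>] 0) (𝓝 (a 0)) := by
      have h1 : Tendsto (fun z : ℝ => ENNReal.ofReal z * (C * 2)) (𝓝[>] 0)
          (𝓝 (ENNReal.ofReal 0 * (C * 2))) :=
        ENNReal.Tendsto.mul_const
          ((ENNReal.continuous_ofReal.tendsto 0).mono_left nhdsWithin_le_nhds)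
          (Or.inr (ENNReal.mul_ne_top hC (by simp)))
      simpa using h1.const_add (a 0)
    refine tendsto_of_tendsto_of_tendsto_of_le_of_le' tendsto_const_nhds hup ?_ hev
    exact Eventually.of_forall fun z => by rw [hsplit]; exact le_self_add
  have hzero : ∀ {a b : ℕ → ℝ≥0∞}, (∀ j, a j ≤ C) → (∀ j, b j ≤ C) →
      (∀ z : ℝ, 0 < z → z < 1 →
        ∑' j, a j * ENNReal.ofReal z ^ j = ∑' j, b j * ENNReal.ofReal z ^ j) → a 0 = b 0 := by
    intro a b ha hb h
    refine tendsto_nhds_unique (hlim a ha) ((hlim b hb).congr' ?_)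
    filter_upwards [Ioo_mem_nhdsGT (show (0 : ℝ) < 1 by norm_num)] with z hz
    exact (h z hz.1 hz.2).symm
  induction k with
  | zero => exact hzero
  | succ k ih =>
    intro a b ha hb h
    -- Once the constant terms agree, they are cancelled and z is divided out, which shifts the
    -- coefficients; hence the induction over all pairs of sequences.
    refine ih (a := fun j => a (j + 1)) (b := fun j => b (j + 1)) (fun j => ha _) (fun j => hb _)
      fun z hz0 hz1 => ?_
    have := h z hz0 hz1
    rw [hsplit a, hsplit b, hzero ha hb h,
      ENNReal.add_right_inj ((hb 0).trans_lt hC.lt_top).ne] at this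
    exact (ENNReal.mul_right_inj (by simpa using hz0) ENNReal.ofReal_ne_top).1 this

/-! ### Points above a level and their independence of the sum below -/

/-- The points `X 0, X 1, …` of the real line have the probability generating functional of a
Poisson process with intensity measure `Λ`. -/
structure HasPoissonFunctional {Ω : Type*} [MeasurableSpace Ω] (μ : Measure Ω) (Λ : Measure ℝ)
    (X : ℕ → Ω → ℝ) : Prop where
  measurable_point : ∀ n, Measurable (X n)
  lintegral_infProd : ∀ v : ℝ → ℝ≥0∞, Measurable v → (∀ x, v x ≤ 1) → ∫⁻ x, v x ∂Λ ≠ ⊤ →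
    ∫⁻ ω, infProd (fun n => 1 - v (X n ω)) ∂μ = ENNReal.ofReal (Real.exp (-(∫⁻ x, v x ∂Λ).toReal))

/-- The number of points above the level `a`. -/
noncomputable def countAbove {Ω : Type*} (X : ℕ → Ω → ℝ) (a : ℝ) (ω : Ω) : ℕ∞ :=
  {n | a < X n ω}.encard

/-- The sum of the (positive) points not above the level `g`. -/
noncomputable def sumBelow {Ω : Type*} (X : ℕ → Ω → ℝ) (g : ℝ) (ω : Ω) : ℝ≥0∞ :=
  ∑' n, (Iic g).indicator ENNReal.ofReal (X n ω)

/-- The Laplace exponent of the sum of the points of `(0, g]`. -/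
noncomputable def laplaceExponent (Λ : Measure ℝ) (g s : ℝ) : ℝ :=
  ∫ y in Ioc 0 g, (1 - Real.exp (-(s * y))) ∂Λ

theorem laplaceExponent_nonneg {Λ : Measure ℝ} {g s : ℝ} (hs : 0 ≤ s) : 0 ≤ laplaceExponent Λ g s :=
  setIntegral_nonneg measurableSet_Ioc fun y hy =>
    sub_nonneg.2 (Real.exp_le_one_iff.2 (by nlinarith [hy.1]))

namespace HasPoissonFunctional

variable {Ω : Type*} [MeasurableSpace Ω] {μ : Measure Ω} {Λ : Measure ℝ} {X : ℕ → Ω → ℝ}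

theorem measurable_countAbove (hX : HasPoissonFunctional μ Λ X) (a : ℝ) :
    Measurable (countAbove X a) :=
  measurable_encard_setOf fun n => measurableSet_lt measurable_const (hX.measurable_point n)

theorem measurable_sumBelow (hX : HasPoissonFunctional μ Λ X) (g : ℝ) :
    Measurable (sumBelow X g) :=
  Measurable.tsum fun n =>
    (ENNReal.measurable_ofReal.indicator measurableSet_Iic).comp (hX.measurable_point n)

theorem integrableOn_one_sub_exp {g s : ℝ} (hs : 0 ≤ s)
    (hint : IntegrableOn (fun y : ℝ => y) (Ioc 0 g) Λ) :
    IntegrableOn (fun y : ℝ => 1 - Real.exp (-(s * y))) (Ioc 0 g) Λ := by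
  refine Integrable.mono' (hint.const_mul s) (by fun_prop) ?_
  filter_upwards [ae_restrict_mem measurableSet_Ioc] with y hy
  have h1 : 0 ≤ s * y := mul_nonneg hs hy.1.le
  have h2 : Real.exp (-(s * y)) ≤ 1 := Real.exp_le_one_iff.2 (by linarith)
  rw [Real.norm_eq_abs, abs_of_nonneg (by linarith)]
  linarith [Real.add_one_le_exp (-(s * y))]

theorem lintegral_generating (hX : HasPoissonFunctional μ Λ X) {g a s z : ℝ} (hga : g ≤ a)
    (hs : 0 ≤ s) (hz0 : 0 ≤ z) (hz1 : z < 1) (ha : Λ (Ioi a) ≠ ⊤)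
    (hint : IntegrableOn (fun y : ℝ => y) (Ioc 0 g) Λ) :
    ∫⁻ ω, ∑' k : ℕ, {ω | countAbove X a ω = k}.indicator
      (fun ω => expNeg (ENNReal.ofReal s * sumBelow X g ω)) ω * ENNReal.ofReal z ^ k ∂μ =
    ENNReal.ofReal (Real.exp (-(Λ.real (Ioi a) * (1 - z) + laplaceExponent Λ g s))) := by
  classical
  have hd : Disjoint (Ioi a) (Ioc 0 g) :=
    Set.disjoint_left.2 fun y h1 h2 => (h2.2.trans hga).not_gt h1
  -- This v is chosen so that 1 - v(y) is z above a, e^(-sy) on (0, g] and 1 elsewhere; the product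
  -- over the points is then z^N e^(-sS).
  let v : ℝ → ℝ≥0∞ := fun y => (Ioi a).indicator (fun _ => ENNReal.ofReal (1 - z)) y +
    (Ioc 0 g).indicator (fun y => ENNReal.ofReal (1 - Real.exp (-(s * y)))) y
  have hm1 : Measurable ((Ioi a).indicator (fun _ : ℝ => ENNReal.ofReal (1 - z))) :=
    measurable_const.indicator measurableSet_Ioi
  have hm2 : Measurable ((Ioc 0 g).indicator
      (fun y => ENNReal.ofReal (1 - Real.exp (-(s * y))))) :=
    Measurable.indicator (by fun_prop) measurableSet_Ioc
  have hvm : Measurable v := hm1.add hm2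
  have hfac : ∀ y, 1 - v y = (if a < y then ENNReal.ofReal z else 1) *
      expNeg (ENNReal.ofReal s * (Iic g).indicator ENNReal.ofReal y) := by
    intro y
    by_cases h1 : a < y
    · have h2 : y ∉ Ioc 0 g := fun h => Set.disjoint_left.1 hd h1 h
      have h3 : y ∉ Iic g := fun h => (hga.trans_lt h1).not_ge h
      simp only [v, indicator_of_mem (show y ∈ Ioi a from h1), indicator_of_notMem h2,
        indicator_of_notMem h3, if_pos h1, mul_zero, expNeg_zero, mul_one, add_zero]
      rw [← ENNReal.ofReal_one, ← ENNReal.ofReal_sub _ (by linarith), sub_sub_cancel]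
    · by_cases h2 : y ∈ Ioc 0 g
      · have h3 : y ∈ Iic g := h2.2
        have h0 : 0 ≤ s * y := mul_nonneg hs h2.1.le
        have h4 : Real.exp (-(s * y)) ≤ 1 := Real.exp_le_one_iff.2 (by linarith)
        simp only [v, indicator_of_notMem (show y ∉ Ioi a from h1), indicator_of_mem h2,
          indicator_of_mem h3, if_neg h1, one_mul, zero_add]
        rw [← ENNReal.ofReal_mul hs, expNeg_ofReal h0, ← ENNReal.ofReal_one,
          ← ENNReal.ofReal_sub _ (by linarith), sub_sub_cancel]
      · have h3 : (Iic g).indicator ENNReal.ofReal y = 0 := by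
          by_cases h : y ∈ Iic g
          · rw [indicator_of_mem h, ENNReal.ofReal_eq_zero]
            by_contra h5
            exact h2 ⟨not_le.1 h5, h⟩
          · exact indicator_of_notMem h _
        simp only [v, indicator_of_notMem (show y ∉ Ioi a from h1), indicator_of_notMem h2, h3,
          if_neg h1, mul_zero, expNeg_zero, mul_one, add_zero, tsub_zero]
  have hv1 : ∀ y, v y ≤ 1 := by
    intro y
    by_cases h1 : y ∈ Ioi a
    · have h2 : y ∉ Ioc 0 g := fun h => Set.disjoint_left.1 hd h1 h
      simp only [v, indicator_of_mem h1, indicator_of_notMem h2, add_zero]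
      exact ENNReal.ofReal_le_one.2 (by linarith)
    · simp only [v, indicator_of_notMem h1, zero_add]
      refine indicator_le' (fun y _ => ENNReal.ofReal_le_one.2 ?_) (fun _ _ => zero_le) y
      linarith [Real.exp_pos (-(s * y))]
  have hexp : ∫⁻ y in Ioc 0 g, ENNReal.ofReal (1 - Real.exp (-(s * y))) ∂Λ =
      ENNReal.ofReal (laplaceExponent Λ g s) := by
    rw [laplaceExponent, ofReal_integral_eq_lintegral_ofReal (integrableOn_one_sub_exp hs hint)]
    filter_upwards [ae_restrict_mem measurableSet_Ioc] with y hy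
    exact sub_nonneg.2 (Real.exp_le_one_iff.2 (by nlinarith [hy.1]))
  have hv : ∫⁻ y, v y ∂Λ = ENNReal.ofReal (1 - z) * Λ (Ioi a) +
      ENNReal.ofReal (laplaceExponent Λ g s) := by
    rw [lintegral_add_left hm1, lintegral_indicator_const measurableSet_Ioi,
      lintegral_indicator measurableSet_Ioc, hexp]
  have hexp0 : 0 ≤ laplaceExponent Λ g s := laplaceExponent_nonneg hs
  have hvt : ENNReal.ofReal (1 - z) * Λ (Ioi a) ≠ ⊤ := ENNReal.mul_ne_top ENNReal.ofReal_ne_top ha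
  have key := hX.lintegral_infProd v hvm hv1 (by rw [hv]; simp [hvt])
  rw [hv, ENNReal.toReal_add hvt ENNReal.ofReal_ne_top, ENNReal.toReal_mul,
    ENNReal.toReal_ofReal (by linarith), ENNReal.toReal_ofReal hexp0, mul_comm (1 - z)] at key
  rw [← Measure.real] at key
  rw [← key]
  refine lintegral_congr fun ω => ?_
  simp_rw [hfac]
  rw [infProd_mul (fun n => by split_ifs <;> simp [hz1.le]) (fun n => expNeg_le_one _),
    infProd_expNeg, ENNReal.tsum_mul_left, ← sumBelow]
  -- With infinitely many points above a, the product vanishes because z < 1, and no finite k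
  -- contributes to the series: both sides are 0.
  by_cases hN : countAbove X a ω = ⊤
  · rw [infProd_ite_of_infinite (Set.encard_eq_top_iff.1 hN) _ (by simpa using hz1)]
    simp [indicator, hN]
  · obtain ⟨k, hk⟩ := ENat.ne_top_iff_exists.1 hN
    rw [tsum_eq_single k, indicator_of_mem (show ω ∈ {ω | countAbove X a ω = k} from hk.symm),
      mul_comm]
    · congr 1
      have hf : {n | a < X n ω}.Finite := Set.encard_ne_top_iff.1 hN
      have := infProd_ite hf (ENNReal.ofReal z) (by simpa using hz1.le)
      rw [show {n | a < X n ω}.ncard = k by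
        rw [Set.ncard, ← countAbove, ← hk, ENat.toNat_natCast]] at this
      rw [← this]
    · intro j hj
      rw [indicator_of_notMem, zero_mul]
      intro h
      have h' : countAbove X a ω = j := h
      rw [← hk] at h'
      exact hj (by exact_mod_cast h'.symm)

/-- The number of points above `a` is Poisson distributed and independent of the sum of the points
of `(0, g]`, `g ≤ a`, whose Laplace transform is given. -/
theorem setLIntegral_expNeg (hX : HasPoissonFunctional μ Λ X) [IsProbabilityMeasure μ] {g a s : ℝ}
    (hga : g ≤ a) (hs : 0 ≤ s) (ha : Λ (Ioi a) ≠ ⊤)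
    (hint : IntegrableOn (fun y : ℝ => y) (Ioc 0 g) Λ) (k : ℕ) :
    ∫⁻ ω in {ω | countAbove X a ω = k}, expNeg (ENNReal.ofReal s * sumBelow X g ω) ∂μ =
      ENNReal.ofReal (Real.exp (-(Λ.real (Ioi a))) * Λ.real (Ioi a) ^ k / (k.factorial : ℝ)) *
        ENNReal.ofReal (Real.exp (-(laplaceExponent Λ g s))) := by
  have hms : ∀ k : ℕ, MeasurableSet {ω | countAbove X a ω = k} := fun k =>
    hX.measurable_countAbove a (measurableSet_singleton _)
  have hW : Measurable fun ω => expNeg (ENNReal.ofReal s * sumBelow X g ω) :=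
    continuous_expNeg.measurable.comp ((hX.measurable_sumBelow g).const_mul _)
  have hexp0 : 0 ≤ laplaceExponent Λ g s := laplaceExponent_nonneg hs
  have hΛ0 : 0 ≤ Λ.real (Ioi a) := measureReal_nonneg
  -- Both sides are the coefficients of z^k in the joint transform, bounded by 1.
  refine eq_of_tsum_mul_pow_eq ENNReal.one_ne_top k
    (a := fun k : ℕ => ∫⁻ ω in {ω | countAbove X a ω = k},
      expNeg (ENNReal.ofReal s * sumBelow X g ω) ∂μ)
    (b := fun k => ENNReal.ofReal (Real.exp (-(Λ.real (Ioi a))) * Λ.real (Ioi a) ^ k /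
      (k.factorial : ℝ)) * ENNReal.ofReal (Real.exp (-(laplaceExponent Λ g s)))) ?_ ?_ ?_
  · intro j
    calc _ ≤ ∫⁻ ω, expNeg (ENNReal.ofReal s * sumBelow X g ω) ∂μ := setLIntegral_le_lintegral _ _
      _ ≤ ∫⁻ ω, 1 ∂μ := lintegral_mono fun ω => expNeg_le_one _
      _ = 1 := by simp
  · intro j
    refine mul_le_one' ?_ (ENNReal.ofReal_le_one.2 (Real.exp_le_one_iff.2 (by linarith)))
    have := ENNReal.le_tsum (f := fun k : ℕ => ENNReal.ofReal (Real.exp (-(Λ.real (Ioi a))) *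
      Λ.real (Ioi a) ^ k / (k.factorial : ℝ)) * ENNReal.ofReal 1 ^ k) j
    rw [poisson_tsum _ 1 hΛ0 zero_le_one] at this
    simpa using this
  · intro z hz0 hz1
    have hr : ∀ k : ℕ, ENNReal.ofReal (Real.exp (-(Λ.real (Ioi a))) * Λ.real (Ioi a) ^ k /
        (k.factorial : ℝ)) * ENNReal.ofReal (Real.exp (-(laplaceExponent Λ g s))) *
          ENNReal.ofReal z ^ k = ENNReal.ofReal (Real.exp (-(laplaceExponent Λ g s))) *
        (ENNReal.ofReal (Real.exp (-(Λ.real (Ioi a))) * Λ.real (Ioi a) ^ k /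
        (k.factorial : ℝ)) * ENNReal.ofReal z ^ k) := fun k => by ring
    simp_rw [hr]
    rw [ENNReal.tsum_mul_left, poisson_tsum _ z hΛ0 hz0.le, ← ENNReal.ofReal_mul (by positivity),
      ← Real.exp_add]
    have h := hX.lintegral_generating hga hs hz0.le hz1 ha hint
    rw [lintegral_tsum fun k => ((hW.indicator (hms k)).mul_const _).aemeasurable] at h
    rw [neg_add_rev] at h
    rw [← h]
    congr 1 with k
    rw [lintegral_mul_const _ (hW.indicator (hms k)), lintegral_indicator (hms k)]

end HasPoissonFunctional

/-! ### Moments from the Laplace transform -/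

/-- Fatou gives the lower bound and domination by the limit itself the upper one. No integrability
of F is needed, so finiteness of the moments becomes a conclusion. -/
theorem tendsto_lintegral_of_le {Ω : Type*} [MeasurableSpace Ω] {μ : Measure Ω}
    {f : ℕ → Ω → ℝ≥0∞} {F : Ω → ℝ≥0∞} (hf : ∀ n, Measurable (f n)) (hle : ∀ n ω, f n ω ≤ F ω)
    (hlim : ∀ ω, Tendsto (fun n => f n ω) atTop (𝓝 (F ω))) :
    Tendsto (fun n => ∫⁻ ω, f n ω ∂μ) atTop (𝓝 (∫⁻ ω, F ω ∂μ)) := by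
  refine tendsto_of_le_liminf_of_limsup_le ?_ ?_
  · calc ∫⁻ ω, F ω ∂μ = ∫⁻ ω, liminf (fun n => f n ω) atTop ∂μ :=
          lintegral_congr fun ω => (hlim ω).liminf_eq.symm
      _ ≤ _ := lintegral_liminf_le hf
  · exact limsup_le_of_le (by isBoundedDefault)
      (Eventually.of_forall fun n => lintegral_mono (hle n))

/-- Squeeze by d/(1+d) ≤ 1 - e^(-d) ≤ d. -/
theorem tendsto_mul_one_sub_exp {c d : ℕ → ℝ} {m : ℝ} (hc : ∀ n, 0 ≤ c n) (hd0 : ∀ n, 0 ≤ d n)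
    (hd : Tendsto d atTop (𝓝 0)) (hcd : Tendsto (fun n => c n * d n) atTop (𝓝 m)) :
    Tendsto (fun n => c n * (1 - Real.exp (-(d n)))) atTop (𝓝 m) := by
  have hlow : Tendsto (fun n => c n * d n / (1 + d n)) atTop (𝓝 m) := by
    have := hcd.div (hd.const_add 1) (by norm_num)
    rw [add_zero, div_one] at this
    exact this
  refine tendsto_of_tendsto_of_tendsto_of_le_of_le hlow hcd (fun n => ?_) fun n => ?_
  · have h1 : 0 < 1 + d n := by linarith [hd0 n]
    have h2 : Real.exp (-(d n)) ≤ 1 / (1 + d n) := by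
      rw [Real.exp_neg, ← one_div]
      exact one_div_le_one_div_of_le h1 (by linarith [Real.add_one_le_exp (d n)])
    have h3 : c n * d n / (1 + d n) = c n * (1 - 1 / (1 + d n)) := by field_simp; ring
    simp only
    rw [h3]
    exact mul_le_mul_of_nonneg_left (by linarith) (hc n)
  · exact mul_le_mul_of_nonneg_left (by linarith [Real.add_one_le_exp (-(d n))]) (hc n)

theorem tendsto_one_div_succ : Tendsto (fun n : ℕ => 1 / ((n : ℝ) + 1)) atTop (𝓝 0) :=
  tendsto_one_div_add_atTop_nhds_zero_nat

/-- The difference quotient at `0` of the Laplace transform of the Dirac mass at `x`. -/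
noncomputable def expQuotient (n : ℕ) (x : ℝ≥0∞) : ℝ :=
  ((n : ℝ) + 1) * (1 - (expNeg (ENNReal.ofReal (1 / ((n : ℝ) + 1)) * x)).toReal)

theorem toReal_expNeg_le_one (x : ℝ≥0∞) : (expNeg x).toReal ≤ 1 := by
  simpa using ENNReal.toReal_mono ENNReal.one_ne_top (expNeg_le_one x)

theorem expQuotient_nonneg (n : ℕ) (x : ℝ≥0∞) : 0 ≤ expQuotient n x :=
  mul_nonneg (by positivity) (sub_nonneg.2 (toReal_expNeg_le_one _))

theorem expQuotient_ofReal (n : ℕ) {r : ℝ} (hr : 0 ≤ r) : expQuotient n (ENNReal.ofReal r) =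
    ((n : ℝ) + 1) * (1 - Real.exp (-(1 / ((n : ℝ) + 1) * r))) := by
  rw [expQuotient, ← ENNReal.ofReal_mul (by positivity), expNeg_ofReal (by positivity),
    ENNReal.toReal_ofReal (Real.exp_pos _).le]

theorem expQuotient_le (n : ℕ) (x : ℝ≥0∞) : ENNReal.ofReal (expQuotient n x) ≤ x := by
  by_cases hx : x = ⊤
  · simp [hx]
  · rw [← ENNReal.ofReal_toReal hx, expQuotient_ofReal n ENNReal.toReal_nonneg]
    refine ENNReal.ofReal_le_ofReal ?_
    have hn : (0 : ℝ) < (n : ℝ) + 1 := by positivity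
    calc ((n : ℝ) + 1) * (1 - Real.exp (-(1 / ((n : ℝ) + 1) * x.toReal)))
        ≤ ((n : ℝ) + 1) * (1 / ((n : ℝ) + 1) * x.toReal) :=
          mul_le_mul_of_nonneg_left
            (by linarith [Real.add_one_le_exp (-(1 / ((n : ℝ) + 1) * x.toReal))]) hn.le
      _ = x.toReal := by field_simp

theorem tendsto_expQuotient (x : ℝ≥0∞) :
    Tendsto (fun n => ENNReal.ofReal (expQuotient n x)) atTop (𝓝 x) := by
  by_cases hx : x = ⊤
  · have : ∀ n : ℕ, ENNReal.ofReal (expQuotient n x) = ((n + 1 : ℕ) : ℝ≥0∞) := fun n => by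
      rw [hx, expQuotient, ENNReal.mul_top (by simpa using by positivity), expNeg_top]
      rw [ENNReal.toReal_zero, sub_zero, mul_one]
      exact_mod_cast ENNReal.ofReal_natCast (n + 1)
    simp_rw [this, hx]
    exact (tendsto_add_atTop_iff_nat 1).2 ENNReal.tendsto_nat_nhds_top
  · obtain ⟨r, hr, rfl⟩ : ∃ r : ℝ, 0 ≤ r ∧ x = ENNReal.ofReal r :=
      ⟨x.toReal, ENNReal.toReal_nonneg, (ENNReal.ofReal_toReal hx).symm⟩
    simp_rw [expQuotient_ofReal _ hr]
    refine (ENNReal.continuous_ofReal.tendsto _).comp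
      (tendsto_mul_one_sub_exp (fun n => by positivity) (fun n => by positivity) ?_ ?_)
    · simpa using tendsto_one_div_succ.mul_const r
    · refine tendsto_const_nhds.congr fun n => ?_
      field_simp

theorem measurable_expQuotient (n : ℕ) : Measurable (expQuotient n) :=
  (measurable_const.sub (continuous_expNeg.measurable.comp
    (measurable_id.const_mul _)).ennreal_toReal).const_mul _

section Moments

variable {Ω : Type*} [MeasurableSpace Ω] {ν : Measure Ω} {S : Ω → ℝ≥0∞}
  {ψ : ℝ → ℝ}

theorem measurable_expNeg_mul (hS : Measurable S) (s : ℝ) :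
    Measurable fun ω => expNeg (ENNReal.ofReal s * S ω) :=
  continuous_expNeg.measurable.comp (hS.const_mul _)

theorem integrable_toReal_expNeg [IsFiniteMeasure ν] (hS : Measurable S) (s : ℝ) :
    Integrable (fun ω => (expNeg (ENNReal.ofReal s * S ω)).toReal) ν := by
  refine Integrable.mono' (integrable_const 1)
    (measurable_expNeg_mul hS s).ennreal_toReal.aestronglyMeasurable (ae_of_all _ fun ω => ?_)
  rw [Real.norm_eq_abs, abs_of_nonneg ENNReal.toReal_nonneg]
  exact toReal_expNeg_le_one _

theorem integral_toReal_expNeg (hS : Measurable S) {s : ℝ}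
    (h : ∫⁻ ω, expNeg (ENNReal.ofReal s * S ω) ∂ν = ν univ * ENNReal.ofReal (Real.exp (-(ψ s)))) :
    ∫ ω, (expNeg (ENNReal.ofReal s * S ω)).toReal ∂ν = ν.real univ * Real.exp (-(ψ s)) := by
  rw [integral_toReal (measurable_expNeg_mul hS s).aemeasurable
    (ae_of_all _ fun ω => (expNeg_le_one _).trans_lt ENNReal.one_lt_top), h, ENNReal.toReal_mul,
    ENNReal.toReal_ofReal (Real.exp_pos _).le, Measure.real]

/-- The integral of the difference quotient is ν(Ω) (n+1)(1 - e^(-ψ(1/(n+1)))), and m₁ plays the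
role of ψ'(0). -/
theorem lintegral_eq_of_laplace [IsFiniteMeasure ν] (hS : Measurable S) (hψ0 : ∀ s, 0 ≤ s → 0 ≤ ψ s)
    (h : ∀ s, 0 ≤ s → ∫⁻ ω, expNeg (ENNReal.ofReal s * S ω) ∂ν =
      ν univ * ENNReal.ofReal (Real.exp (-(ψ s)))) {m₁ : ℝ}
    (h1 : Tendsto (fun n : ℕ => ((n : ℝ) + 1) * ψ (1 / ((n : ℝ) + 1))) atTop (𝓝 m₁)) :
    ∫⁻ ω, S ω ∂ν = ν univ * ENNReal.ofReal m₁ := by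
  have hψ : Tendsto (fun n : ℕ => ψ (1 / ((n : ℝ) + 1))) atTop (𝓝 0) := by
    have := tendsto_one_div_succ.mul h1
    rw [zero_mul] at this
    refine this.congr fun n => ?_
    field_simp
  refine tendsto_nhds_unique (tendsto_lintegral_of_le (f := fun n ω =>
    ENNReal.ofReal (expQuotient n (S ω)))
    (fun n => ((measurable_expQuotient n).comp hS).ennreal_ofReal)
    (fun n ω => expQuotient_le n _) fun ω => tendsto_expQuotient _) ?_
  have hval : ∀ n : ℕ, ∫⁻ ω, ENNReal.ofReal (expQuotient n (S ω)) ∂ν = ENNReal.ofReal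
      (ν.real univ * (((n : ℝ) + 1) * (1 - Real.exp (-(ψ (1 / ((n : ℝ) + 1))))))) := fun n => by
    have hi := integrable_toReal_expNeg (ν := ν) hS (1 / ((n : ℝ) + 1))
    have hi' : Integrable (fun ω => expQuotient n (S ω)) ν :=
      ((integrable_const 1).sub hi).const_mul _
    rw [← ofReal_integral_eq_lintegral_ofReal hi'
      (ae_of_all _ fun ω => expQuotient_nonneg n _)]
    simp only [expQuotient]
    rw [integral_const_mul, integral_sub (integrable_const 1) hi,
      integral_toReal_expNeg hS (h _ (by positivity))]
    simp only [integral_const, smul_eq_mul, mul_one]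
    congr 1
    ring
  simp_rw [hval]
  have hlim := (tendsto_mul_one_sub_exp (fun n => by positivity)
    (fun n => hψ0 _ (by positivity)) hψ h1).const_mul (ν.real univ)
  have := (ENNReal.continuous_ofReal.tendsto _).comp hlim
  rwa [ENNReal.ofReal_mul measureReal_nonneg, ofReal_measureReal] at this

/-- Squaring the difference quotient involves the transform only at s and 2s, so m₂, the analogue of
-ψ''(0), enters through the second difference 2ψ(s) - ψ(2s) without any differentiation. -/
theorem lintegral_sq_eq_of_laplace [IsFiniteMeasure ν] (hS : Measurable S)
    (hψ0 : ∀ s, 0 ≤ s → 0 ≤ ψ s)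
    (hψ2 : ∀ s, 0 ≤ s → ψ (2 * s) ≤ 2 * ψ s)
    (h : ∀ s, 0 ≤ s → ∫⁻ ω, expNeg (ENNReal.ofReal s * S ω) ∂ν =
      ν univ * ENNReal.ofReal (Real.exp (-(ψ s)))) {m₁ m₂ : ℝ}
    (h1 : Tendsto (fun n : ℕ => ((n : ℝ) + 1) * ψ (1 / ((n : ℝ) + 1))) atTop (𝓝 m₁))
    (h2 : Tendsto (fun n : ℕ => ((n : ℝ) + 1) ^ 2 *
      (2 * ψ (1 / ((n : ℝ) + 1)) - ψ (2 * (1 / ((n : ℝ) + 1))))) atTop (𝓝 m₂)) :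
    ∫⁻ ω, S ω ^ 2 ∂ν = ν univ * ENNReal.ofReal (m₁ ^ 2 + m₂) := by
  have hψ : Tendsto (fun n : ℕ => ψ (1 / ((n : ℝ) + 1))) atTop (𝓝 0) := by
    have := tendsto_one_div_succ.mul h1
    rw [zero_mul] at this
    refine this.congr fun n => ?_
    field_simp
  have hd : Tendsto (fun n : ℕ => 2 * ψ (1 / ((n : ℝ) + 1)) - ψ (2 * (1 / ((n : ℝ) + 1))))
      atTop (𝓝 0) := by
    have := (tendsto_one_div_succ.pow 2).mul h2
    rw [zero_pow two_ne_zero, zero_mul] at this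
    refine this.congr fun n => ?_
    field_simp
  have hψd : Tendsto (fun n : ℕ => ψ (2 * (1 / ((n : ℝ) + 1)))) atTop (𝓝 0) := by
    have := (hψ.const_mul 2).sub hd
    simpa using this
  refine tendsto_nhds_unique (tendsto_lintegral_of_le (f := fun n ω =>
    ENNReal.ofReal (expQuotient n (S ω)) ^ 2)
    (fun n => (((measurable_expQuotient n).comp hS).ennreal_ofReal).pow_const 2)
    (fun n ω => pow_le_pow_left' (expQuotient_le n _) 2)
    fun ω => ENNReal.Tendsto.pow (tendsto_expQuotient _)) ?_
  -- The identity used is 1 - 2e^(-ψ(s)) + e^(-ψ(2s)) = (1 - e^(-ψ(s)))² + e^(-ψ(2s)) (1 -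
  -- e^(-(2ψ(s) - ψ(2s)))): squared mean plus variance.
  have hval : ∀ n : ℕ, ∫⁻ ω, ENNReal.ofReal (expQuotient n (S ω)) ^ 2 ∂ν = ENNReal.ofReal
      (ν.real univ * ((((n : ℝ) + 1) * (1 - Real.exp (-(ψ (1 / ((n : ℝ) + 1)))))) ^ 2 +
        Real.exp (-(ψ (2 * (1 / ((n : ℝ) + 1))))) * (((n : ℝ) + 1) ^ 2 * (1 - Real.exp
          (-(2 * ψ (1 / ((n : ℝ) + 1)) - ψ (2 * (1 / ((n : ℝ) + 1))))))))) := fun n => by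
    have hs : (0 : ℝ) ≤ 1 / ((n : ℝ) + 1) := by positivity
    have hi := integrable_toReal_expNeg (ν := ν) hS (1 / ((n : ℝ) + 1))
    have hi2 := integrable_toReal_expNeg (ν := ν) hS (2 * (1 / ((n : ℝ) + 1)))
    have hsq : ∀ ω, expQuotient n (S ω) ^ 2 = ((n : ℝ) + 1) ^ 2 *
        (1 - 2 * (expNeg (ENNReal.ofReal (1 / ((n : ℝ) + 1)) * S ω)).toReal +
          (expNeg (ENNReal.ofReal (2 * (1 / ((n : ℝ) + 1))) * S ω)).toReal) := fun ω => by
      rw [expQuotient, two_mul (1 / ((n : ℝ) + 1)), ENNReal.ofReal_add hs hs,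
        add_mul (ENNReal.ofReal _), expNeg_add, ENNReal.toReal_mul]
      ring
    simp_rw [← ENNReal.ofReal_pow (expQuotient_nonneg n _)]
    have hi3 : Integrable (fun ω => 1 - 2 *
        (expNeg (ENNReal.ofReal (1 / ((n : ℝ) + 1)) * S ω)).toReal) ν :=
      (integrable_const 1).sub (hi.const_mul 2)
    have hi4 : Integrable (fun ω => expQuotient n (S ω) ^ 2) ν := by
      simp_rw [hsq]
      exact (hi3.add hi2).const_mul _
    rw [← ofReal_integral_eq_lintegral_ofReal hi4 (ae_of_all _ fun ω => sq_nonneg _)]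
    simp_rw [hsq]
    rw [integral_const_mul, integral_add hi3 hi2, integral_sub (integrable_const 1)
      (hi.const_mul 2), integral_const_mul, integral_toReal_expNeg hS (h _ hs),
      integral_toReal_expNeg hS (h _ (by positivity))]
    simp only [integral_const, smul_eq_mul, mul_one]
    congr 1
    have he : Real.exp (-(ψ (2 * (1 / ((n : ℝ) + 1))))) * Real.exp
        (-(2 * ψ (1 / ((n : ℝ) + 1)) - ψ (2 * (1 / ((n : ℝ) + 1))))) =
        Real.exp (-(ψ (1 / ((n : ℝ) + 1)))) ^ 2 := by
      rw [← Real.exp_add, ← Real.exp_nat_mul]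
      congr 1
      push_cast
      ring
    linear_combination (-(ν.real univ * ((n : ℝ) + 1) ^ 2)) * (- he)
  simp_rw [hval]
  have hl1 := (tendsto_mul_one_sub_exp (fun n => by positivity)
    (fun n => hψ0 _ (by positivity)) hψ h1).pow 2
  have hl2 := tendsto_mul_one_sub_exp (c := fun n : ℕ => ((n : ℝ) + 1) ^ 2)
    (fun n => by positivity)
    (fun n => sub_nonneg.2 (hψ2 (1 / ((n : ℝ) + 1)) (by positivity))) hd h2
  have hl3 : Tendsto (fun n : ℕ => Real.exp (-(ψ (2 * (1 / ((n : ℝ) + 1)))))) atTop (𝓝 1) := by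
    have := (Real.continuous_exp.tendsto _).comp hψd.neg
    rw [neg_zero, Real.exp_zero] at this
    exact this
  have hlim := (hl1.add (hl3.mul hl2)).const_mul (ν.real univ)
  have := (ENNReal.continuous_ofReal.tendsto _).comp hlim
  rwa [ENNReal.ofReal_mul measureReal_nonneg, ofReal_measureReal, one_mul] at this

end Moments

/-! ### Behaviour of the Laplace exponent at 0 -/

section LaplaceExponent

variable {Λ : Measure ℝ} {g : ℝ}

theorem laplaceExponent_zero : laplaceExponent Λ g 0 = 0 := by
  simp [laplaceExponent]

/-- Pointwise, 2(1 - e) - (1 - e²) = (1 - e)² with e = e^(-sy). The right side is nonnegative and,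
rescaled by s^(-2), is dominated by y². -/
theorem two_mul_laplaceExponent_sub (hint : IntegrableOn (fun y : ℝ => y) (Ioc 0 g) Λ) {s : ℝ}
    (hs : 0 ≤ s) : 2 * laplaceExponent Λ g s - laplaceExponent Λ g (2 * s) =
      ∫ y in Ioc 0 g, (1 - Real.exp (-(s * y))) ^ 2 ∂Λ := by
  have h1 := HasPoissonFunctional.integrableOn_one_sub_exp hs hint
  have h2 := HasPoissonFunctional.integrableOn_one_sub_exp (mul_nonneg zero_le_two hs) hint
  rw [laplaceExponent, laplaceExponent, ← integral_const_mul, ← integral_sub (h1.const_mul 2) h2]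
  refine integral_congr_ae (ae_of_all _ fun y => ?_)
  have : Real.exp (-(2 * s * y)) = Real.exp (-(s * y)) ^ 2 := by
    rw [← Real.exp_nat_mul]
    congr 1
    push_cast
    ring
  simp only [this]
  ring

theorem laplaceExponent_two_mul_le (hint : IntegrableOn (fun y : ℝ => y) (Ioc 0 g) Λ) {s : ℝ}
    (hs : 0 ≤ s) : laplaceExponent Λ g (2 * s) ≤ 2 * laplaceExponent Λ g s := by
  rw [← sub_nonneg, two_mul_laplaceExponent_sub hint hs]
  exact integral_nonneg fun y => sq_nonneg _

theorem tendsto_succ_mul_one_sub_exp (y : ℝ) (hy : 0 ≤ y) :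
    Tendsto (fun n : ℕ => ((n : ℝ) + 1) * (1 - Real.exp (-(1 / ((n : ℝ) + 1) * y)))) atTop
      (𝓝 y) := by
  refine tendsto_mul_one_sub_exp (fun n => by positivity) (fun n => by positivity) ?_ ?_
  · simpa using tendsto_one_div_succ.mul_const y
  · refine tendsto_const_nhds.congr fun n => ?_
    field_simp

theorem abs_succ_mul_one_sub_exp_le (n : ℕ) {y : ℝ} (hy : 0 ≤ y) :
    |((n : ℝ) + 1) * (1 - Real.exp (-(1 / ((n : ℝ) + 1) * y)))| ≤ y := by
  have hn : (0 : ℝ) < (n : ℝ) + 1 := by positivity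
  have h0 : 0 ≤ 1 / ((n : ℝ) + 1) * y := by positivity
  have h1 : Real.exp (-(1 / ((n : ℝ) + 1) * y)) ≤ 1 := Real.exp_le_one_iff.2 (by linarith)
  rw [abs_of_nonneg (mul_nonneg hn.le (sub_nonneg.2 h1))]
  calc ((n : ℝ) + 1) * (1 - Real.exp (-(1 / ((n : ℝ) + 1) * y)))
      ≤ ((n : ℝ) + 1) * (1 / ((n : ℝ) + 1) * y) := mul_le_mul_of_nonneg_left
        (by linarith [Real.add_one_le_exp (-(1 / ((n : ℝ) + 1) * y))]) hn.le
    _ = y := by field_simp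

theorem tendsto_succ_mul_laplaceExponent (hint : IntegrableOn (fun y : ℝ => y) (Ioc 0 g) Λ) :
    Tendsto (fun n : ℕ => ((n : ℝ) + 1) * laplaceExponent Λ g (1 / ((n : ℝ) + 1))) atTop
      (𝓝 (∫ y in Ioc 0 g, y ∂Λ)) := by
  simp_rw [laplaceExponent, ← integral_const_mul]
  refine tendsto_integral_of_dominated_convergence (fun y => y) (fun n => by fun_prop) hint
    (fun n => ?_) ?_
  · filter_upwards [ae_restrict_mem measurableSet_Ioc] with y hy
    exact abs_succ_mul_one_sub_exp_le n hy.1.le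
  · filter_upwards [ae_restrict_mem measurableSet_Ioc] with y hy
    exact tendsto_succ_mul_one_sub_exp y hy.1.le

theorem tendsto_sq_mul_laplaceExponent (hint : IntegrableOn (fun y : ℝ => y) (Ioc 0 g) Λ)
    (hint2 : IntegrableOn (fun y : ℝ => y ^ 2) (Ioc 0 g) Λ) :
    Tendsto (fun n : ℕ => ((n : ℝ) + 1) ^ 2 * (2 * laplaceExponent Λ g (1 / ((n : ℝ) + 1)) -
      laplaceExponent Λ g (2 * (1 / ((n : ℝ) + 1))))) atTop (𝓝 (∫ y in Ioc 0 g, y ^ 2 ∂Λ)) := by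
  have : ∀ n : ℕ, ((n : ℝ) + 1) ^ 2 * (2 * laplaceExponent Λ g (1 / ((n : ℝ) + 1)) -
      laplaceExponent Λ g (2 * (1 / ((n : ℝ) + 1)))) =
      ∫ y in Ioc 0 g, (((n : ℝ) + 1) * (1 - Real.exp (-(1 / ((n : ℝ) + 1) * y)))) ^ 2 ∂Λ := by
    intro n
    rw [two_mul_laplaceExponent_sub hint (by positivity), ← integral_const_mul]
    simp_rw [mul_pow]
  simp_rw [this]
  refine tendsto_integral_of_dominated_convergence (fun y => y ^ 2) (fun n => by fun_prop) hint2
    (fun n => ?_) ?_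
  · filter_upwards [ae_restrict_mem measurableSet_Ioc] with y hy
    rw [Real.norm_eq_abs, abs_pow]
    exact pow_le_pow_left₀ (abs_nonneg _) (abs_succ_mul_one_sub_exp_le n hy.1.le) 2
  · filter_upwards [ae_restrict_mem measurableSet_Ioc] with y hy
    exact (tendsto_succ_mul_one_sub_exp y hy.1.le).pow 2

end LaplaceExponent

/-! ### The sum below a level when fewer than L points lie above -/

theorem setOf_countAbove_lt {Ω : Type*} (X : ℕ → Ω → ℝ) (a : ℝ) (L : ℕ) :
    {ω | countAbove X a ω < L} = ⋃ k ∈ Finset.range L, {ω | countAbove X a ω = k} := by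
  ext ω
  simp only [mem_ofPred_eq, mem_iUnion, Finset.mem_range, exists_prop]
  constructor
  · intro h
    obtain ⟨k, hk⟩ := ENat.ne_top_iff_exists.1 (h.trans_le le_top).ne
    rw [← hk] at h
    exact ⟨k, by exact_mod_cast h, hk.symm⟩
  · rintro ⟨k, hk, h⟩
    rw [h]
    exact_mod_cast hk

theorem pairwiseDisjoint_countAbove {Ω : Type*} (X : ℕ → Ω → ℝ) (a : ℝ) (L : ℕ) :
    (Finset.range L : Set ℕ).PairwiseDisjoint fun k : ℕ => {ω | countAbove X a ω = k} :=
  fun i _ j _ hij => Set.disjoint_left.2 fun ω h1 h2 => hij (by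
    have h1' : countAbove X a ω = i := h1
    have h2' : countAbove X a ω = j := h2
    rw [h1'] at h2'
    exact_mod_cast h2')

namespace HasPoissonFunctional

variable {Ω : Type*} [MeasurableSpace Ω] {μ : Measure Ω} [IsProbabilityMeasure μ] {Λ : Measure ℝ}
  {X : ℕ → Ω → ℝ} {g a : ℝ}

theorem measure_countAbove_eq (hX : HasPoissonFunctional μ Λ X) (ha : Λ (Ioi a) ≠ ⊤) (k : ℕ) :
    μ {ω | countAbove X a ω = k} = ENNReal.ofReal
      (Real.exp (-(Λ.real (Ioi a))) * Λ.real (Ioi a) ^ k / (k.factorial : ℝ)) := by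
  -- With s = 0 the Laplace factor is 1, and g ≤ 0 makes (0, g] empty, so the integrability
  -- condition is void.
  have h := hX.setLIntegral_expNeg (g := min a 0) (s := 0) (min_le_left a 0) le_rfl ha
    (by rw [Ioc_eq_empty (by simp)]; exact integrableOn_empty) k
  simpa [expNeg_zero, laplaceExponent_zero] using h

theorem ae_countAbove_ne_top (hX : HasPoissonFunctional μ Λ X) (ha : Λ (Ioi a) ≠ ⊤) :
    ∀ᵐ ω ∂μ, countAbove X a ω ≠ ⊤ :=
  ae_ne_top_of_poisson μ (hX.measurable_countAbove a) measureReal_nonneg fun k => by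
    rw [Measure.real, hX.measure_countAbove_eq ha, ENNReal.toReal_ofReal]
    positivity

/-- On the number of points above `a ≥ g`, the sum of the points of `(0, g]` has the Laplace
transform of a compound Poisson law. -/
theorem setLIntegral_expNeg_of_lt (hX : HasPoissonFunctional μ Λ X) (hga : g ≤ a)
    (ha : Λ (Ioi a) ≠ ⊤) (hint : IntegrableOn (fun y : ℝ => y) (Ioc 0 g) Λ) (L : ℕ) {s : ℝ}
    (hs : 0 ≤ s) :
    ∫⁻ ω in {ω | countAbove X a ω < L}, expNeg (ENNReal.ofReal s * sumBelow X g ω) ∂μ =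
      μ {ω | countAbove X a ω < L} * ENNReal.ofReal (Real.exp (-(laplaceExponent Λ g s))) := by
  have hdisj := pairwiseDisjoint_countAbove X a L
  have hms : ∀ k ∈ Finset.range L, MeasurableSet {ω | countAbove X a ω = k} := fun k _ =>
    hX.measurable_countAbove a (measurableSet_singleton _)
  rw [setOf_countAbove_lt, lintegral_biUnion_finset hdisj hms, measure_biUnion_finset hdisj hms,
    Finset.sum_mul]
  refine Finset.sum_congr rfl fun k _ => ?_
  rw [hX.setLIntegral_expNeg hga hs ha hint, hX.measure_countAbove_eq ha]

theorem setLIntegral_sumBelow (hX : HasPoissonFunctional μ Λ X) (hga : g ≤ a)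
    (ha : Λ (Ioi a) ≠ ⊤) (hint : IntegrableOn (fun y : ℝ => y) (Ioc 0 g) Λ) (L : ℕ) :
    ∫⁻ ω in {ω | countAbove X a ω < L}, sumBelow X g ω ∂μ =
      μ {ω | countAbove X a ω < L} * ENNReal.ofReal (∫ y in Ioc 0 g, y ∂Λ) := by
  have := lintegral_eq_of_laplace (ν := μ.restrict {ω | countAbove X a ω < L})
    (hX.measurable_sumBelow g) (fun s hs => laplaceExponent_nonneg hs)
    (fun s hs => by
      rw [Measure.restrict_apply_univ]
      exact hX.setLIntegral_expNeg_of_lt hga ha hint L hs)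
    (tendsto_succ_mul_laplaceExponent hint)
  rwa [Measure.restrict_apply_univ] at this

theorem setLIntegral_sumBelow_sq (hX : HasPoissonFunctional μ Λ X) (hga : g ≤ a)
    (ha : Λ (Ioi a) ≠ ⊤) (hint : IntegrableOn (fun y : ℝ => y) (Ioc 0 g) Λ)
    (hint2 : IntegrableOn (fun y : ℝ => y ^ 2) (Ioc 0 g) Λ) (L : ℕ) :
    ∫⁻ ω in {ω | countAbove X a ω < L}, sumBelow X g ω ^ 2 ∂μ =
      μ {ω | countAbove X a ω < L} *
        ENNReal.ofReal ((∫ y in Ioc 0 g, y ∂Λ) ^ 2 + ∫ y in Ioc 0 g, y ^ 2 ∂Λ) := by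
  have := lintegral_sq_eq_of_laplace (ν := μ.restrict {ω | countAbove X a ω < L})
    (hX.measurable_sumBelow g) (fun s hs => laplaceExponent_nonneg hs)
    (fun s hs => laplaceExponent_two_mul_le hint hs)
    (fun s hs => by
      rw [Measure.restrict_apply_univ]
      exact hX.setLIntegral_expNeg_of_lt hga ha hint L hs)
    (tendsto_succ_mul_laplaceExponent hint) (tendsto_sq_mul_laplaceExponent hint hint2)
  rwa [Measure.restrict_apply_univ] at this

end HasPoissonFunctional

/-! ### The L-th largest term -/

theorem nthLargest_nonneg (L : ℕ) (a : ℕ → ℝ) : 0 ≤ nthLargest L a :=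
  Real.sInf_nonneg fun _ hx => hx.1

/-- Here no level is admissible and `sInf ∅ = 0`. -/
theorem nthLargest_eq_zero {L : ℕ} {a : ℕ → ℝ}
    (h : ∀ k : ℕ, {n : ℕ | (k : ℝ) < a n}.encard = ⊤) : nthLargest L a = 0 := by
  rw [nthLargest, show {x : ℝ | 0 ≤ x ∧ {n : ℕ | x < a n}.encard < (L : ℕ∞)} = ∅ from ?_,
    Real.sInf_empty]
  refine Set.eq_empty_of_forall_notMem fun x hx => ?_
  obtain ⟨k, hk⟩ := exists_nat_ge x
  have h1 : {n : ℕ | (k : ℝ) < a n}.encard ≤ {n : ℕ | x < a n}.encard :=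
    Set.encard_le_encard fun n hn => hk.trans_lt hn
  rw [h k] at h1
  exact (hx.2.trans_le le_top).not_ge h1

/-- The infimum is attained, so the event G ≤ x is a statement about a count. Finitely many terms
above some x₀ guarantee an admissible level, which excludes the default value of `sInf`. -/
theorem nthLargest_le_iff {L : ℕ} (hL : 1 ≤ L) {a : ℕ → ℝ} {x₀ : ℝ} (hx₀ : 0 ≤ x₀)
    (hfin : {n : ℕ | x₀ < a n}.encard ≠ ⊤) {x : ℝ} (hx : 0 ≤ x) :
    nthLargest L a ≤ x ↔ {n : ℕ | x < a n}.encard < (L : ℕ∞) := by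
  have hbdd : BddBelow {x : ℝ | 0 ≤ x ∧ {n : ℕ | x < a n}.encard < (L : ℕ∞)} :=
    ⟨0, fun _ hx => hx.1⟩
  have hne : {x : ℝ | 0 ≤ x ∧ {n : ℕ | x < a n}.encard < (L : ℕ∞)}.Nonempty := by
    obtain ⟨M, hM⟩ := ((Set.encard_ne_top_iff.1 hfin).image a).bddAbove
    refine ⟨max M x₀, hx₀.trans (le_max_right _ _), ?_⟩
    rw [show {n : ℕ | max M x₀ < a n} = ∅ from ?_, Set.encard_empty]
    · exact_mod_cast hL
    · refine Set.eq_empty_of_forall_notMem fun n hn => ?_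
      have hn' : max M x₀ < a n := hn
      have := hM (mem_image_of_mem a (show n ∈ {n | x₀ < a n} from (le_max_right _ _).trans_lt hn'))
      exact ((le_max_left _ _).trans_lt hn').not_ge this
  constructor
  · intro h
    by_contra! hc
    -- Among L terms above x let a m be the smallest. Any level below a m still has these L terms
    -- above it, so it is not admissible.
    obtain ⟨t, ht, htc⟩ := Set.exists_subset_encard_eq hc
    have htf : t.Finite := Set.finite_of_encard_eq_coe htc
    have htne : t.Nonempty := by
      rw [← Set.encard_ne_zero, htc]
      exact_mod_cast (by omega : L ≠ 0)
    obtain ⟨m, hm, hmin⟩ := Set.exists_min_image t a htf htne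
    have hxm : x < a m := ht hm
    obtain ⟨y, hy, hyx⟩ := (csInf_lt_iff hbdd hne).1 (h.trans_lt hxm)
    refine hy.2.not_ge ?_
    rw [← htc]
    exact Set.encard_le_encard fun n hn => hyx.trans_le (hmin n hn)
  · intro h
    exact csInf_le hbdd ⟨hx, h⟩

theorem measurable_nthLargest {Ω : Type*} [MeasurableSpace Ω] {L : ℕ} (hL : 1 ≤ L)
    {X : ℕ → Ω → ℝ} (hX : ∀ n, Measurable (X n)) :
    Measurable fun ω => nthLargest L (fun n => X n ω) := by
  have hc : ∀ x : ℝ, Measurable (countAbove X x) := fun x =>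
    measurable_encard_setOf fun n => measurableSet_lt measurable_const (hX n)
  refine measurable_of_Iic fun x => ?_
  rcases lt_or_ge x 0 with hx | hx
  · rw [show (fun ω => nthLargest L (fun n => X n ω)) ⁻¹' Iic x = ∅ from
      Set.eq_empty_of_forall_notMem fun ω hω =>
        ((nthLargest_nonneg L (fun n => X n ω)).trans hω).not_gt hx]
    exact MeasurableSet.empty
  -- The first set collects the outcomes where every level is exceeded infinitely often and the
  -- default value 0 is taken.
  · have : (fun ω => nthLargest L (fun n => X n ω)) ⁻¹' Iic x =
        (⋂ k : ℕ, countAbove X k ⁻¹' {⊤}) ∪ countAbove X x ⁻¹' Iio (L : ℕ∞) := by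
      ext ω
      simp only [mem_preimage, mem_Iic, mem_union, mem_iInter, mem_singleton_iff, mem_Iio]
      by_cases h : ∀ k : ℕ, countAbove X k ω = ⊤
      · simp only [h, implies_true, true_or, iff_true]
        rw [nthLargest_eq_zero h]
        exact hx
      · simp only [h, false_or]
        obtain ⟨k, hk⟩ := not_forall.1 h
        exact nthLargest_le_iff hL k.cast_nonneg hk hx
    rw [this]
    exact (MeasurableSet.iInter fun k : ℕ =>
      hc (k : ℝ) (measurableSet_singleton _)).union
      (hc x (.of_discrete (s := Iio (L : ℕ∞))))

/-! ### Distribution of the L-th largest point -/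

/-- The probability that a Poisson variable with mean `t` is less than `L`. -/
noncomputable def poissonCdf (L : ℕ) (t : ℝ) : ℝ :=
  ∑ k ∈ Finset.range L, Real.exp (-t) * t ^ k / (k.factorial : ℝ)

/-- The derivative of each term cancels the leading part of the next one, so only the last term
survives. -/
theorem hasDerivAt_poissonCdf (m : ℕ) (t : ℝ) :
    HasDerivAt (poissonCdf (m + 1)) (-(Real.exp (-t) * t ^ m / (m.factorial : ℝ))) t := by
  have he : HasDerivAt (fun t : ℝ => Real.exp (-t)) (-Real.exp (-t)) t := by
    simpa using (hasDerivAt_neg t).exp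
  induction m with
  | zero =>
    have : poissonCdf (0 + 1) = fun t : ℝ => Real.exp (-t) := by
      ext t; simp [poissonCdf]
    rw [this]
    simpa using he
  | succ m ih =>
    have : poissonCdf (m + 1 + 1) = fun t => poissonCdf (m + 1) t +
        Real.exp (-t) * t ^ (m + 1) / ((m + 1).factorial : ℝ) := by
      ext t; rw [poissonCdf, Finset.sum_range_succ, ← poissonCdf]
    rw [this]
    refine (ih.add ((he.mul (hasDerivAt_pow (m + 1) t)).div_const _)).congr_deriv ?_
    rw [Nat.factorial_succ]
    push_cast
    have h1 : (m.factorial : ℝ) ≠ 0 := by positivity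
    have h2 : (m : ℝ) + 1 ≠ 0 := by positivity
    field_simp
    ring

theorem poissonCdf_zero {L : ℕ} (hL : 1 ≤ L) : poissonCdf L 0 = 1 := by
  obtain ⟨m, rfl⟩ : ∃ m, L = m + 1 := ⟨L - 1, by omega⟩
  simp [poissonCdf, Finset.sum_range_succ']

theorem poissonCdf_nonneg (L : ℕ) {t : ℝ} (ht : 0 ≤ t) : 0 ≤ poissonCdf L t :=
  Finset.sum_nonneg fun k _ => by positivity

theorem tendsto_poissonCdf_atTop (L : ℕ) : Tendsto (poissonCdf L) atTop (𝓝 0) := by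
  have : Tendsto (fun t : ℝ => ∑ k ∈ Finset.range L, Real.exp (-t) * t ^ k / (k.factorial : ℝ))
      atTop (𝓝 (∑ k ∈ Finset.range L, 0)) := by
    refine tendsto_finsetSum _ fun k _ => ?_
    have := (Real.tendsto_pow_mul_exp_neg_atTop_nhds_zero k).div_const (k.factorial : ℝ)
    rw [zero_div] at this
    exact this.congr fun t => by ring
  rw [Finset.sum_const_zero] at this
  exact this

theorem continuous_poissonCdf (L : ℕ) : Continuous (poissonCdf L) := by
  unfold poissonCdf
  fun_prop

theorem ext_of_Ioi_of_Iic_zero {μ ν : Measure ℝ} [IsFiniteMeasure μ] (hμ : μ (Iic 0) = 0)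
    (hν : ν (Iic 0) = 0) (h : ∀ x, 0 < x → μ (Ioi x) = ν (Ioi x)) : μ = ν := by
  have hU : (⋃ n : ℕ, Ioi (1 / ((n : ℝ) + 1))) = Ioi 0 := by
    ext x
    simp only [mem_iUnion, mem_Ioi]
    exact ⟨fun ⟨n, hn⟩ => lt_trans (by positivity) hn, fun hx => exists_nat_one_div_lt hx⟩
  have hmono : Monotone fun n : ℕ => Ioi (1 / ((n : ℝ) + 1)) := fun n m hnm =>
    Ioi_subset_Ioi (one_div_le_one_div_of_le (by positivity) (by simpa using hnm))
  have h0 : μ (Ioi 0) = ν (Ioi 0) := by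
    rw [← hU, hmono.measure_iUnion, hmono.measure_iUnion]
    congr 1 with n
    exact h _ (by positivity)
  refine Measure.ext_of_Iic _ _ fun a => ?_
  rcases le_or_gt a 0 with ha | ha
  · rw [measure_mono_null (Iic_subset_Iic.2 ha) hμ, measure_mono_null (Iic_subset_Iic.2 ha) hν]
  · have hsplit : ∀ κ : Measure ℝ, κ (Iic 0) = 0 → κ (Iic a) = κ (Ioi 0 \ Ioi a) := fun κ hκ => by
      rw [Ioi_sdiff_Ioi, ← Iic_union_Ioc_eq_Iic ha.le, measure_union' (by simp)
        measurableSet_Iic, hκ, zero_add]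
    rw [hsplit μ hμ, hsplit ν hν,
      measure_sdiff (Ioi_subset_Ioi ha.le) measurableSet_Ioi.nullMeasurableSet (measure_ne_top _ _),
      measure_sdiff (Ioi_subset_Ioi ha.le) measurableSet_Ioi.nullMeasurableSet
        (by rw [← h a ha]; exact measure_ne_top _ _), h0, h a ha]

/-- The integrand is the derivative of g ↦ `poissonCdf (m + 1) (c * g ^ (-δ))`, which tends to
`poissonCdf (m + 1) 0 = 1` at infinity. -/
theorem lintegral_Ioi_poissonCdf (m : ℕ) {c δ x : ℝ} (hc : 0 < c) (hδ : 0 < δ) (hx : 0 < x) :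
    ∫⁻ g in Ioi x, ENNReal.ofReal (δ * c ^ (m + 1) * g ^ (-δ * ((m + 1 : ℕ) : ℝ) - 1) /
      (m.factorial : ℝ) * Real.exp (-(c * g ^ (-δ)))) =
      ENNReal.ofReal (1 - poissonCdf (m + 1) (c * x ^ (-δ))) := by
  have hderiv : ∀ g ∈ Ici x, HasDerivAt (fun g => poissonCdf (m + 1) (c * g ^ (-δ)))
      (δ * c ^ (m + 1) * g ^ (-δ * ((m + 1 : ℕ) : ℝ) - 1) /
      (m.factorial : ℝ) * Real.exp (-(c * g ^ (-δ)))) g := fun g hg => by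
    have hg0 : 0 < g := hx.trans_le hg
    have h1 := (Real.hasDerivAt_rpow_const (p := -δ) (Or.inl hg0.ne')).const_mul c
    refine ((hasDerivAt_poissonCdf m (c * g ^ (-δ))).comp g h1).congr_deriv ?_
    have : g ^ (-δ * ((m + 1 : ℕ) : ℝ) - 1) = (g ^ (-δ)) ^ m * g ^ (-δ - 1) := by
      rw [← Real.rpow_natCast, ← Real.rpow_mul hg0.le, ← Real.rpow_add hg0]
      congr 1
      push_cast
      ring
    rw [this, mul_pow]
    ring
  have hpos : ∀ g ∈ Ioi x, 0 ≤ δ * c ^ (m + 1) * g ^ (-δ * ((m + 1 : ℕ) : ℝ) - 1) /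
      (m.factorial : ℝ) * Real.exp (-(c * g ^ (-δ))) := fun g hg => by
    have hg0 : 0 < g := hx.trans hg
    positivity
  have hlim : Tendsto (fun g => poissonCdf (m + 1) (c * g ^ (-δ))) atTop (𝓝 1) := by
    have h1 : Tendsto (fun g : ℝ => c * g ^ (-δ)) atTop (𝓝 0) := by
      simpa using (tendsto_rpow_neg_atTop hδ).const_mul c
    have := ((continuous_poissonCdf (m + 1)).tendsto 0).comp h1
    rwa [poissonCdf_zero (by omega)] at this
  rw [← integral_Ioi_of_hasDerivAt_of_nonneg' hderiv hpos hlim,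
    ofReal_integral_eq_lintegral_ofReal (integrableOn_Ioi_deriv_of_nonneg' hderiv hpos hlim)]
  filter_upwards [ae_restrict_mem measurableSet_Ioi] with g hg using hpos g hg

namespace HasPoissonFunctional

variable {Ω : Type*} [MeasurableSpace Ω] {μ : Measure Ω} [IsProbabilityMeasure μ] {Λ : Measure ℝ}
  {X : ℕ → Ω → ℝ} {L : ℕ}

theorem measure_countAbove_lt (hX : HasPoissonFunctional μ Λ X) {a : ℝ} (ha : Λ (Ioi a) ≠ ⊤)
    (L : ℕ) : μ {ω | countAbove X a ω < L} = ENNReal.ofReal (poissonCdf L (Λ.real (Ioi a))) := by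
  have hms : ∀ k ∈ Finset.range L, MeasurableSet {ω | countAbove X a ω = k} := fun k _ =>
    hX.measurable_countAbove a (measurableSet_singleton _)
  rw [setOf_countAbove_lt, measure_biUnion_finset (pairwiseDisjoint_countAbove X a L) hms,
    poissonCdf,
    ENNReal.ofReal_sum_of_nonneg fun k _ => by positivity]
  exact Finset.sum_congr rfl fun k _ => hX.measure_countAbove_eq ha k

theorem nthLargest_le_ae_eq (hX : HasPoissonFunctional μ Λ X) (hL : 1 ≤ L) {x : ℝ} (hx : 0 ≤ x)
    (hΛ : Λ (Ioi x) ≠ ⊤) :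
    {ω | nthLargest L (fun n => X n ω) ≤ x} =ᵐ[μ] {ω | countAbove X x ω < L} := by
  rw [eventuallyEq_set]
  filter_upwards [hX.ae_countAbove_ne_top hΛ] with ω hω
  exact nthLargest_le_iff hL hx hω hx

variable {c δ : ℝ}

/-- Λ((x, ∞)) blows up as x → 0+, so the probability of fewer than L points above x tends to 0. -/
theorem nthLargest_pos (hX : HasPoissonFunctional μ Λ X) (hL : 1 ≤ L) (hc : 0 < c) (hδ : 0 < δ)
    (hΛ : ∀ x, 0 < x → Λ (Ioi x) = ENNReal.ofReal (c * x ^ (-δ))) :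
    ∀ᵐ ω ∂μ, 0 < nthLargest L (fun n => X n ω) := by
  have hle : ∀ x, 0 < x → μ {ω | nthLargest L (fun n => X n ω) ≤ 0} ≤
      ENNReal.ofReal (poissonCdf L (c * x ^ (-δ))) := fun x hx => by
    have hf : Λ (Ioi x) ≠ ⊤ := by rw [hΛ x hx]; exact ENNReal.ofReal_ne_top
    calc _ ≤ μ {ω | nthLargest L (fun n => X n ω) ≤ x} :=
          measure_mono fun ω (hω : _ ≤ _) => hω.trans hx.le
      _ = _ := by
        rw [measure_congr (hX.nthLargest_le_ae_eq hL hx.le hf), hX.measure_countAbove_lt hf,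
          Measure.real, hΛ x hx, ENNReal.toReal_ofReal (by positivity)]
  have hlim : Tendsto (fun x : ℝ => ENNReal.ofReal (poissonCdf L (c * x ^ (-δ)))) (𝓝[>] 0)
      (𝓝 0) := by
    have h1 : Tendsto (fun x : ℝ => c * x ^ (-δ)) (𝓝[>] 0) atTop :=
      (tendsto_rpow_neg_nhdsGT_zero (by linarith)).const_mul_atTop hc
    have := (ENNReal.continuous_ofReal.tendsto 0).comp ((tendsto_poissonCdf_atTop L).comp h1)
    rw [ENNReal.ofReal_zero] at this
    exact this
  have h0 : μ {ω | nthLargest L (fun n => X n ω) ≤ 0} = 0 := by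
    refine le_antisymm (ge_of_tendsto hlim ?_) zero_le
    filter_upwards [self_mem_nhdsWithin] with x hx using hle x hx
  rw [ae_iff]
  simpa using h0

theorem map_nthLargest (hX : HasPoissonFunctional μ Λ X) (hL : 1 ≤ L) (hc : 0 < c) (hδ : 0 < δ)
    (hΛ : ∀ x, 0 < x → Λ (Ioi x) = ENNReal.ofReal (c * x ^ (-δ))) :
    μ.map (fun ω => nthLargest L (fun n => X n ω)) = (volume.restrict (Ioi (0 : ℝ))).withDensity
      (fun g => ENNReal.ofReal (δ * c ^ L * g ^ (-δ * (L : ℝ) - 1) / Real.Gamma L *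
        Real.exp (-(c * g ^ (-δ))))) := by
  have hm := measurable_nthLargest hL hX.measurable_point
  have : IsProbabilityMeasure (μ.map fun ω => nthLargest L (fun n => X n ω)) :=
    Measure.isProbabilityMeasure_map hm.aemeasurable
  refine ext_of_Ioi_of_Iic_zero ?_ ?_ fun x hx => ?_
  · rw [Measure.map_apply hm measurableSet_Iic]
    have := hX.nthLargest_pos hL hc hδ hΛ
    rw [ae_iff] at this
    simpa [preimage] using this
  · rw [withDensity_apply _ measurableSet_Iic, Measure.restrict_restrict measurableSet_Iic,
      show Iic (0 : ℝ) ∩ Ioi 0 = ∅ by ext; simp]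
    simp
  · have hf : Λ (Ioi x) ≠ ⊤ := by rw [hΛ x hx]; exact ENNReal.ofReal_ne_top
    rw [withDensity_apply _ measurableSet_Ioi, Measure.restrict_restrict measurableSet_Ioi,
      inter_eq_left.2 (Ioi_subset_Ioi hx.le), ← compl_Iic, prob_compl_eq_one_sub measurableSet_Iic,
      Measure.map_apply hm measurableSet_Iic,
      show (fun ω => nthLargest L (fun n => X n ω)) ⁻¹' Iic x =
        {ω | nthLargest L (fun n => X n ω) ≤ x} from rfl,
      measure_congr (hX.nthLargest_le_ae_eq hL hx.le hf), hX.measure_countAbove_lt hf,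
      Measure.real, hΛ x hx, ENNReal.toReal_ofReal (by positivity), compl_Iic]
    obtain ⟨m, rfl⟩ : ∃ m, L = m + 1 := ⟨L - 1, by omega⟩
    have hG : Real.Gamma ((m + 1 : ℕ) : ℝ) = m.factorial := by
      rw [← Real.Gamma_nat_eq_factorial]; push_cast; rfl
    rw [hG, lintegral_Ioi_poissonCdf m hc hδ hx, ENNReal.ofReal_sub _ (poissonCdf_nonneg _
      (by positivity)), ENNReal.ofReal_one]

end HasPoissonFunctional

/-! ### Dyadic approximation of a random level from below -/

/-- The largest multiple of `2 ^ (-k)` that is strictly less than `x > 0`. -/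
noncomputable def dyadicBelow (k : ℕ) (x : ℝ) : ℝ := ((⌈2 ^ k * x⌉₊ - 1 : ℕ) : ℝ) / 2 ^ k

theorem dyadicBelow_nonneg (k : ℕ) (x : ℝ) : 0 ≤ dyadicBelow k x := by
  unfold dyadicBelow; positivity

theorem cast_ceil_sub_one {y : ℝ} (hy : 0 < y) : ((⌈y⌉₊ - 1 : ℕ) : ℝ) = (⌈y⌉₊ : ℝ) - 1 := by
  rw [Nat.cast_sub (Nat.ceil_pos.2 hy), Nat.cast_one]

theorem dyadicBelow_lt (k : ℕ) {x : ℝ} (hx : 0 < x) : dyadicBelow k x < x := by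
  have hy : 0 < 2 ^ k * x := by positivity
  rw [dyadicBelow, cast_ceil_sub_one hy, div_lt_iff₀ (by positivity)]
  linarith [Nat.ceil_lt_add_one hy.le]

theorem le_dyadicBelow_add (k : ℕ) {x : ℝ} (hx : 0 < x) : x - 1 / 2 ^ k ≤ dyadicBelow k x := by
  have hy : 0 < 2 ^ k * x := by positivity
  rw [dyadicBelow, cast_ceil_sub_one hy, le_div_iff₀ (by positivity), sub_mul,
    div_mul_cancel₀ _ (by positivity)]
  linarith [Nat.le_ceil (2 ^ k * x)]

theorem monotone_dyadicBelow {x : ℝ} (hx : 0 < x) : Monotone fun k => dyadicBelow k x := by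
  refine monotone_nat_of_le_succ fun k => ?_
  have h1 := (div_lt_iff₀ (by positivity)).1 (dyadicBelow_lt k hx)
  have h2 : 2 * (⌈2 ^ k * x⌉₊ - 1) < ⌈2 ^ (k + 1) * x⌉₊ := by
    rw [Nat.lt_ceil]
    push_cast
    rw [pow_succ]
    linarith
  have h3 : ((2 * (⌈2 ^ k * x⌉₊ - 1) : ℕ) : ℝ) ≤ ((⌈2 ^ (k + 1) * x⌉₊ - 1 : ℕ) : ℝ) := by
    exact_mod_cast Nat.le_sub_one_of_lt h2
  rw [dyadicBelow, dyadicBelow, div_le_div_iff₀ (by positivity) (by positivity)]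
  generalize ⌈2 ^ (k + 1) * x⌉₊ - 1 = d at h3 ⊢
  push_cast at h3
  rw [pow_succ]
  nlinarith [show (0 : ℝ) < 2 ^ k by positivity]

theorem tendsto_dyadicBelow {x : ℝ} (hx : 0 < x) :
    Tendsto (fun k => dyadicBelow k x) atTop (𝓝 x) := by
  have h : Tendsto (fun k : ℕ => x - 1 / 2 ^ k) atTop (𝓝 x) := by
    have := (tendsto_pow_atTop_nhds_zero_of_lt_one (r := (1 / 2 : ℝ)) (by norm_num)
      (by norm_num)).const_sub x
    simpa using this
  exact tendsto_of_tendsto_of_tendsto_of_le_of_le h tendsto_const_nhds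
    (fun k => le_dyadicBelow_add k hx) fun k => (dyadicBelow_lt k hx).le

theorem measurable_natCeil_dyadic (k : ℕ) : Measurable fun x : ℝ => ⌈2 ^ k * x⌉₊ - 1 :=
  (Measurable.of_discrete (f := fun n : ℕ => n - 1)).comp
    (Nat.measurable_ceil.comp (measurable_const_mul _))

theorem measurable_dyadicBelow (k : ℕ) : Measurable (dyadicBelow k) :=
  ((Measurable.of_discrete (f := fun n : ℕ => (n : ℝ))).comp
    (measurable_natCeil_dyadic k)).div_const _

section LeftLimit

variable {Ω : Type*} [MeasurableSpace Ω] {μ : Measure Ω} {G : Ω → ℝ} {Φ : ℝ → Ω → ℝ≥0∞}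
  {M : ℝ → ℝ≥0∞}

theorem measurable_comp_dyadicBelow (hG : Measurable G) (hΦ : ∀ g, Measurable (Φ g)) (k : ℕ) :
    Measurable fun ω => Φ (dyadicBelow k (G ω)) ω := by
  have h : Measurable fun p : ℕ × Ω => Φ ((p.1 : ℝ) / 2 ^ k) p.2 :=
    measurable_from_prod_countable_right fun j => hΦ ((j : ℝ) / 2 ^ k)
  exact h.comp (((measurable_natCeil_dyadic k).comp hG).prodMk measurable_id)

/-- On the cell where the dyadic level equals j/2^k the level is deterministic. The approximation is
strict, so the cell lies in (j/2^k, ∞) and the factorization at that fixed level applies. -/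
theorem setLIntegral_comp_dyadicBelow (hG : Measurable G)
    (h : ∀ g, 0 ≤ g → ∀ A, MeasurableSet A → A ⊆ Ioi g →
      ∫⁻ ω in G ⁻¹' A, Φ g ω ∂μ = M g * μ (G ⁻¹' A)) (k : ℕ) {A : Set ℝ} (hA : MeasurableSet A)
    (hA0 : A ⊆ Ioi 0) :
    ∫⁻ ω in G ⁻¹' A, Φ (dyadicBelow k (G ω)) ω ∂μ =
      ∫⁻ x in A, M (dyadicBelow k x) ∂(μ.map G) := by
  let B : ℕ → Set ℝ := fun j => A ∩ {x | ⌈2 ^ k * x⌉₊ - 1 = j}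
  have hB : ∀ j, MeasurableSet (B j) := fun j =>
    hA.inter (measurable_natCeil_dyadic k (measurableSet_singleton j))
  have hU : A = ⋃ j, B j := by
    ext x
    simp only [B, mem_iUnion, mem_inter_iff, mem_ofPred_eq, exists_and_left, exists_eq', and_true]
  have hd : Pairwise (Function.onFun Disjoint B) := fun i j hij =>
    Set.disjoint_left.2 fun x h1 h2 => hij (h1.2.symm.trans h2.2)
  have hdy : ∀ j, ∀ x ∈ B j, dyadicBelow k x = (j : ℝ) / 2 ^ k := fun j x hx => by
    rw [dyadicBelow, show ⌈2 ^ k * x⌉₊ - 1 = j from hx.2]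
  rw [hU, preimage_iUnion, lintegral_iUnion (fun j => hG (hB j))
    (fun i j hij => (hd hij).preimage G), lintegral_iUnion hB hd]
  refine tsum_congr fun j => ?_
  rw [setLIntegral_congr_fun (g := fun ω => Φ ((j : ℝ) / 2 ^ k) ω) (hG (hB j))
      (fun ω hω => by simp only [hdy j _ hω]),
    setLIntegral_congr_fun (g := fun _ => M ((j : ℝ) / 2 ^ k)) (hB j)
      (fun x hx => by simp only [hdy j _ hx]),
    setLIntegral_const, Measure.map_apply hG (hB j)]
  refine h _ (by positivity) _ (hB j) fun x hx => ?_
  rw [mem_Ioi, ← hdy j x hx]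
  exact dyadicBelow_lt k (hA0 hx.1)

/-- Passage to the left limit at a random level. -/
theorem setLIntegral_iSup_dyadicBelow (hG : Measurable G) (hΦ : ∀ g, Measurable (Φ g))
    (hΦm : ∀ ω, Monotone fun g => Φ g ω) (hM : Measurable M) (hMm : MonotoneOn M (Ici 0))
    (h : ∀ g, 0 ≤ g → ∀ A, MeasurableSet A → A ⊆ Ioi g →
      ∫⁻ ω in G ⁻¹' A, Φ g ω ∂μ = M g * μ (G ⁻¹' A)) {A : Set ℝ} (hA : MeasurableSet A)
    (hA0 : A ⊆ Ioi 0) :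
    ∫⁻ ω in G ⁻¹' A, ⨆ k, Φ (dyadicBelow k (G ω)) ω ∂μ =
      ∫⁻ x in A, ⨆ k, M (dyadicBelow k x) ∂(μ.map G) := by
  rw [lintegral_iSup_ae (fun k => measurable_comp_dyadicBelow hG hΦ k),
    lintegral_iSup_ae (f := fun k x => M (dyadicBelow k x))
      (fun k => hM.comp (measurable_dyadicBelow k))]
  · exact iSup_congr fun k => setLIntegral_comp_dyadicBelow hG h k hA hA0
  · intro k
    filter_upwards [ae_restrict_mem hA] with x hx
    exact hMm (dyadicBelow_nonneg _ _) (dyadicBelow_nonneg _ _)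
      (monotone_dyadicBelow (hA0 hx) k.le_succ)
  · intro k
    filter_upwards [ae_restrict_mem (hG hA)] with ω hω
    exact hΦm ω (monotone_dyadicBelow (hA0 hω) k.le_succ)

end LeftLimit

/-! ### The sum strictly below the L-th largest point -/

/-- The sum of the (positive) points strictly below the level `g`. -/
noncomputable def sumStrictlyBelow {Ω : Type*} (X : ℕ → Ω → ℝ) (g : ℝ) (ω : Ω) : ℝ≥0∞ :=
  ∑' n, (Iio g).indicator ENNReal.ofReal (X n ω)

theorem monotone_indicator_Iic (x : ℝ) :
    Monotone fun g => (Iic g).indicator ENNReal.ofReal x := fun _ _ h =>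
  Set.indicator_le_indicator_of_subset (Iic_subset_Iic.2 h) (fun _ => zero_le) x

theorem sumBelow_zero {Ω : Type*} (X : ℕ → Ω → ℝ) (ω : Ω) : sumBelow X 0 ω = 0 := by
  rw [sumBelow, ENNReal.tsum_eq_zero]
  intro n
  by_cases h : X n ω ∈ Iic 0
  · rw [indicator_of_mem h, ENNReal.ofReal_eq_zero]; exact h
  · exact indicator_of_notMem h _

theorem monotone_sumBelow {Ω : Type*} (X : ℕ → Ω → ℝ) (ω : Ω) :
    Monotone fun g => sumBelow X g ω := fun _ _ h =>
  ENNReal.tsum_le_tsum fun _ => monotone_indicator_Iic _ h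

/-- The dyadic levels increase to g without reaching it, so every point below g is eventually
counted and points equal to g never are. -/
theorem iSup_sumBelow_dyadicBelow {Ω : Type*} (X : ℕ → Ω → ℝ) {g : ℝ} (hg : 0 < g) (ω : Ω) :
    ⨆ k, sumBelow X (dyadicBelow k g) ω = sumStrictlyBelow X g ω := by
  have hpt : ∀ x, ⨆ k, (Iic (dyadicBelow k g)).indicator ENNReal.ofReal x =
      (Iio g).indicator ENNReal.ofReal x := by
    intro x
    refine le_antisymm (iSup_le fun k => Set.indicator_le_indicator_of_subset
      (Iic_subset_Iio.2 (dyadicBelow_lt k hg)) (fun _ => zero_le) x) ?_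
    by_cases hx : x < g
    · obtain ⟨k, hk⟩ := ((tendsto_dyadicBelow hg).eventually (lt_mem_nhds hx)).exists
      refine le_iSup_of_le k ?_
      rw [indicator_of_mem (show x ∈ Iio g from hx), indicator_of_mem (show x ∈ Iic _ from hk.le)]
    · rw [indicator_of_notMem (show x ∉ Iio g from hx)]
      exact zero_le
  unfold sumBelow sumStrictlyBelow
  simp_rw [ENNReal.tsum_eq_iSup_sum]
  rw [iSup_comm]
  congr 1 with s
  rw [← ENNReal.finsetSum_iSup_of_monotone
    (f := fun n k => (Iic (dyadicBelow k g)).indicator ENNReal.ofReal (X n ω)) fun n =>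
    (monotone_indicator_Iic (X n ω)).comp (monotone_dyadicBelow hg)]
  simp_rw [hpt]

namespace HasPoissonFunctional

variable {Ω : Type*} [MeasurableSpace Ω] {μ : Measure Ω} [IsProbabilityMeasure μ] {Λ : Measure ℝ}
  {X : ℕ → Ω → ℝ} {L : ℕ}

/-- If the integral of `F` over `{G ≤ a}` factorizes for all `a ≥ g`, then so does its integral over
`{G ∈ A}` for every Borel set `A` above `g`. -/
theorem setLIntegral_preimage_eq {G : Ω → ℝ} (hG : Measurable G) {F : Ω → ℝ≥0∞}
    {m : ℝ≥0∞} (hm : m ≠ ⊤) {g : ℝ}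
    (h : ∀ a, g ≤ a → ∫⁻ ω in G ⁻¹' Iic a, F ω ∂μ = μ (G ⁻¹' Iic a) * m) {A : Set ℝ}
    (hA : MeasurableSet A) (hAg : A ⊆ Ioi g) :
    ∫⁻ ω in G ⁻¹' A, F ω ∂μ = m * μ (G ⁻¹' A) := by
  have hGm : IsProbabilityMeasure (μ.map G) := Measure.isProbabilityMeasure_map hG.aemeasurable
  -- Both sides, as functions of A, are measures on (g, ∞); it suffices to compare half-lines, where
  -- the value at g is subtracted from the value at a.
  have hEq : (m • μ.map G).restrict (Ioi g) = ((μ.withDensity F).map G).restrict (Ioi g) := by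
    have hfin : IsFiniteMeasure ((m • μ.map G).restrict (Ioi g)) :=
      ⟨by
        rw [Measure.restrict_apply_univ, Measure.smul_apply, smul_eq_mul]
        exact ENNReal.mul_lt_top hm.lt_top (measure_lt_top _ _)⟩
    refine Measure.ext_of_Iic _ _ fun a => ?_
    rw [Measure.restrict_apply measurableSet_Iic, Measure.restrict_apply measurableSet_Iic]
    rcases le_or_gt a g with hag | hag
    · rw [show Iic a ∩ Ioi g = ∅ from ?_]
      · simp
      · ext x
        simp only [mem_inter_iff, mem_Iic, mem_Ioi, mem_empty_iff_false, iff_false, not_and, not_lt]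
        exact fun hx => hx.trans hag
    · have hset : Iic a ∩ Ioi g = Iic a \ Iic g := by
        rw [sdiff_eq, compl_Iic]
      have hval : ∀ b, g ≤ b → ((μ.withDensity F).map G) (Iic b) = (m • μ.map G) (Iic b) :=
        fun b hb => by
          rw [Measure.map_apply hG measurableSet_Iic, withDensity_apply _ (hG measurableSet_Iic),
            h b hb, Measure.smul_apply, Measure.map_apply hG measurableSet_Iic, smul_eq_mul,
            mul_comm]
      have hne : (m • μ.map G) (Iic g) ≠ ⊤ := by
        rw [Measure.smul_apply, smul_eq_mul]
        exact ENNReal.mul_ne_top hm (measure_ne_top _ _)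
      rw [hset, measure_sdiff (Iic_subset_Iic.2 hag.le) measurableSet_Iic.nullMeasurableSet hne,
        measure_sdiff (Iic_subset_Iic.2 hag.le) measurableSet_Iic.nullMeasurableSet
          (by rw [hval g le_rfl]; exact hne), hval a hag.le, hval g le_rfl]
  have := congrArg (fun κ => κ A) hEq
  simp only [Measure.restrict_apply hA, inter_eq_left.2 hAg, Measure.smul_apply, smul_eq_mul,
    Measure.map_apply hG hA, withDensity_apply _ (hG hA)] at this
  exact this.symm

/-- The moments of the sum of the points below the `L`-th largest one, on Borel events of the
latter. -/
theorem setLIntegral_sumStrictlyBelow_pow (hX : HasPoissonFunctional μ Λ X) (hL : 1 ≤ L)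
    (hΛ : ∀ x, 0 < x → Λ (Ioi x) ≠ ⊤) {p : ℕ} (hp : p ≠ 0) {m : ℝ → ℝ} (hmc : Continuous m)
    (hmm : MonotoneOn m (Ici 0)) (hm0 : m 0 = 0)
    (h : ∀ g a, 0 < g → g ≤ a → ∫⁻ ω in {ω | countAbove X a ω < L}, sumBelow X g ω ^ p ∂μ =
      μ {ω | countAbove X a ω < L} * ENNReal.ofReal (m g)) {A : Set ℝ}
    (hA : MeasurableSet A) (hA0 : A ⊆ Ioi 0) :
    ∫⁻ ω in (fun ω => nthLargest L fun n => X n ω) ⁻¹' A,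
        sumStrictlyBelow X (nthLargest L fun n => X n ω) ω ^ p ∂μ =
      ∫⁻ x in A, ENNReal.ofReal (m x) ∂(μ.map fun ω => nthLargest L fun n => X n ω) := by
  have hG := measurable_nthLargest hL hX.measurable_point
  set G : Ω → ℝ := fun ω => nthLargest L fun n => X n ω with hGdef
  let M : ℝ → ℝ≥0∞ := fun x => ENNReal.ofReal (m x)
  have hMc : Continuous M := ENNReal.continuous_ofReal.comp hmc
  have hM : Measurable M := hMc.measurable
  have hMm : MonotoneOn M (Ici 0) := fun x hx y _ hxy => ENNReal.ofReal_le_ofReal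
    (hmm hx (le_trans hx hxy) hxy)
  have hfac : ∀ g, 0 ≤ g → ∀ A, MeasurableSet A → A ⊆ Ioi g →
      ∫⁻ ω in G ⁻¹' A, sumBelow X g ω ^ p ∂μ = M g * μ (G ⁻¹' A) := by
    intro g hg A hA hAg
    -- Level 0 occurs as a dyadic level but Λ may be infinite above it; there both the sum and m
    -- vanish.
    rcases hg.eq_or_lt with rfl | hg
    · simp [sumBelow_zero, hp, M, hm0]
    · refine setLIntegral_preimage_eq hG ENNReal.ofReal_ne_top (fun a ha => ?_) hA hAg
      have hae : (G ⁻¹' Iic a : Set Ω) =ᵐ[μ] {ω | countAbove X a ω < L} :=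
        hX.nthLargest_le_ae_eq hL (hg.le.trans ha) (hΛ a (hg.trans_le ha))
      rw [setLIntegral_congr hae, measure_congr hae, h g a hg ha]
  have key := setLIntegral_iSup_dyadicBelow (μ := μ) hG
    (fun g => (hX.measurable_sumBelow g).pow_const p)
    (fun ω x y hxy => pow_le_pow_left' (monotone_sumBelow X ω hxy) p) hM hMm hfac hA hA0
  rw [setLIntegral_congr_fun (g := fun ω => sumStrictlyBelow X (G ω) ω ^ p) (hG hA)
    (fun ω hω => by
      simp only
      rw [← iSup_sumBelow_dyadicBelow X (hA0 hω), ENNReal.iSup_pow]),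
    setLIntegral_congr_fun (g := fun x => ENNReal.ofReal (m x)) hA (fun x hx => ?_)] at key
  · exact key
  · have hx0 : 0 < x := hA0 hx
    have hmono : Monotone fun k => M (dyadicBelow k x) := fun k l hkl =>
      hMm (dyadicBelow_nonneg _ _) (dyadicBelow_nonneg _ _) (monotone_dyadicBelow hx0 hkl)
    refine tendsto_nhds_unique (tendsto_atTop_iSup hmono) ?_
    exact (hMc.tendsto x).comp (tendsto_dyadicBelow hx0)

end HasPoissonFunctional

/-! ### Moments of the conditional distribution -/

theorem moments_of_lintegral {κ : Measure ℝ} [IsProbabilityMeasure κ] (h0 : ∀ᵐ x ∂κ, 0 ≤ x)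
    {m v : ℝ} (hm : 0 ≤ m) (hv : 0 ≤ v) (h1 : ∫⁻ x, ENNReal.ofReal x ∂κ = ENNReal.ofReal m)
    (h2 : ∫⁻ x, ENNReal.ofReal x ^ 2 ∂κ = ENNReal.ofReal (m ^ 2 + v)) :
    MemLp (fun x : ℝ => x) 2 κ ∧ ∫ x, x ∂κ = m ∧ variance (fun x : ℝ => x) κ = v := by
  have h2' : ∫⁻ x, ENNReal.ofReal (x ^ 2) ∂κ = ENNReal.ofReal (m ^ 2 + v) := by
    rw [← h2]
    refine lintegral_congr_ae ?_
    filter_upwards [h0] with x hx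
    rw [ENNReal.ofReal_pow hx]
  have hsq0 : 0 ≤ᵐ[κ] fun x : ℝ => x ^ 2 := ae_of_all _ fun x => sq_nonneg x
  have hL : MemLp (fun x : ℝ => x) 2 κ := by
    rw [memLp_two_iff_integrable_sq (by fun_prop)]
    refine ⟨by fun_prop, ?_⟩
    rw [hasFiniteIntegral_iff_ofReal hsq0, h2']
    exact ENNReal.ofReal_lt_top
  have hi1 : ∫ x, x ∂κ = m := by
    rw [integral_eq_lintegral_of_nonneg_ae h0 (by fun_prop), h1, ENNReal.toReal_ofReal hm]
  have hi2 : ∫ x, x ^ 2 ∂κ = m ^ 2 + v := by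
    rw [integral_eq_lintegral_of_nonneg_ae hsq0 (by fun_prop), h2',
      ENNReal.toReal_ofReal (by positivity)]
  refine ⟨hL, hi1, ?_⟩
  rw [variance_eq_sub hL]
  simp only [Pi.pow_apply]
  rw [hi1, hi2]
  ring

section CondDistrib

variable {Ω : Type*} [MeasurableSpace Ω] {μ : Measure Ω} [IsProbabilityMeasure μ] {G Y : Ω → ℝ}

/-- Disintegration makes both sides densities of the same measure. The σ-finite uniqueness statement
is used because the total integral may be infinite: for instance E G^(1-δ) diverges when δ(L+1) ≤ 1.
-/
theorem ae_lintegral_condDistrib_eq (hG : Measurable G) (hY : AEMeasurable Y μ) {F m : ℝ → ℝ≥0∞}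
    (hF : Measurable F) (hm : Measurable m)
    (h : ∀ A, MeasurableSet A → ∫⁻ ω in G ⁻¹' A, F (Y ω) ∂μ = ∫⁻ x in A, m x ∂(μ.map G)) :
    ∀ᵐ g ∂(μ.map G), ∫⁻ y, F y ∂(condDistrib Y G μ g) = m g := by
  refine ae_eq_of_forall_setLIntegral_eq_of_sigmaFinite hF.lintegral_kernel hm fun A hA _ => ?_
  have hF2 : Measurable fun p : ℝ × ℝ => F p.2 := hF.comp measurable_snd
  have h1 := Measure.setLIntegral_compProd (μ := μ.map G) (κ := condDistrib Y G μ) hF2 hA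
    MeasurableSet.univ
  simp only [Measure.restrict_univ] at h1
  rw [← h1, ← h A hA, compProd_map_condDistrib hY, ← lintegral_indicator (hA.prod .univ),
    lintegral_map' (hF2.indicator (hA.prod .univ)).aemeasurable (hG.aemeasurable.prodMk hY),
    ← lintegral_indicator (hG hA)]
  refine lintegral_congr fun ω => ?_
  by_cases hω : G ω ∈ A
  · rw [indicator_of_mem (show (G ω, Y ω) ∈ A ×ˢ univ from ⟨hω, mem_univ _⟩),
      indicator_of_mem (show ω ∈ G ⁻¹' A from hω)]
  · rw [indicator_of_notMem (fun hc : (G ω, Y ω) ∈ A ×ˢ univ => hω hc.1),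
      indicator_of_notMem (show ω ∉ G ⁻¹' A from hω)]

theorem ae_condDistrib_nonneg (hG : Measurable G) (hY : AEMeasurable Y μ) (h0 : ∀ᵐ ω ∂μ, 0 ≤ Y ω) :
    ∀ᵐ g ∂(μ.map G), ∀ᵐ y ∂(condDistrib Y G μ g), 0 ≤ y := by
  have h := ae_lintegral_condDistrib_eq (F := (Iio (0 : ℝ)).indicator 1) (m := fun _ => 0) hG hY
    (measurable_one.indicator measurableSet_Iio) measurable_const fun A _ => by
      rw [lintegral_zero, ← nonpos_iff_eq_zero]
      refine (setLIntegral_le_lintegral _ _).trans (le_of_eq ?_)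
      refine lintegral_eq_zero_of_ae_eq_zero ?_
      filter_upwards [h0] with ω hω
      exact indicator_of_notMem (show Y ω ∉ Iio 0 from not_lt.2 hω) _
  filter_upwards [h] with g hg
  rw [lintegral_indicator_one measurableSet_Iio] at hg
  rw [ae_iff]
  simpa [Iio] using hg

end CondDistrib

/-! ### Application to the interference field -/

/-- Moments of the intensity of the interference powers. -/
theorem integral_pow_powerIntensity {α lam : ℝ} (hα : 2 < α) (hlam : 0 < lam) {g : ℝ} (hg : 0 < g)
    {p : ℕ} (hp : 1 ≤ p) :
    IntegrableOn (fun y : ℝ => y ^ p) (Ioc 0 g) (powerIntensity α lam) ∧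
      ∫ y in Ioc 0 g, y ^ p ∂(powerIntensity α lam) =
        Real.pi * Real.Gamma (2 / α + 1) * lam * ((2 / α) / (p - 2 / α)) * g ^ (p - 2 / α) := by
  have hα0 : 0 < α := by linarith
  have hδ : 2 / α < 1 := (div_lt_one hα0).2 hα
  have hp' : (1 : ℝ) ≤ p := by exact_mod_cast hp
  have key := lintegral_rpow_powerIntensity hα0 hlam hg hp' hδ
  simp_rw [Real.rpow_natCast] at key
  have h0 : 0 ≤ᵐ[(powerIntensity α lam).restrict (Ioc 0 g)] fun y : ℝ => y ^ p := by
    filter_upwards [ae_restrict_mem measurableSet_Ioc] with y hy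
    exact pow_nonneg hy.1.le p
  refine ⟨⟨by fun_prop, ?_⟩, ?_⟩
  · rw [hasFiniteIntegral_iff_ofReal h0, key]
    exact ENNReal.ofReal_lt_top
  · rw [integral_eq_lintegral_of_nonneg_ae h0 (by fun_prop), key, ENNReal.toReal_ofReal]
    have := Real.Gamma_pos_of_pos (s := 2 / α + 1) (by positivity)
    have h1 : 0 < (p : ℝ) - 2 / α := by linarith
    positivity

section Interferers

variable {Ω : Type*} {L : ℕ} {α lam : ℝ} {T : ℕ → Ω → Plane} {ρ : ℕ → Ω → ℝ}

theorem IsInterfererField.hasPoissonFunctional [MeasurableSpace Ω] {μ : Measure Ω}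
    [IsProbabilityMeasure μ] (h : IsInterfererField μ lam T ρ) (α : ℝ)
    (hlam : 0 < lam) :
    HasPoissonFunctional μ (powerIntensity α lam) (interferencePower α T ρ) where
  measurable_point := measurable_interferencePower h.poisson.measurable_point h.measurable_fading
  lintegral_infProd _ hv hv1 hf := h.lintegral_infProd_power α hlam hv hv1 hf

theorem IsInterfererField.ae_interferencePower_nonneg [MeasurableSpace Ω] {μ : Measure Ω}
    (h : IsInterfererField μ lam T ρ) (α : ℝ) :
    ∀ᵐ ω ∂μ, ∀ n, 0 ≤ interferencePower α T ρ n ω := by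
  rw [ae_all_iff]
  intro n
  have hpos : ∀ᵐ r ∂(μ.map (ρ n)), 0 < r := by
    rw [h.fading_law n]
    exact ae_expMeasure_one_pos
  filter_upwards [ae_of_ae_map (h.measurable_fading n).aemeasurable hpos] with ω hω
  exact mul_nonneg (Real.rpow_nonneg (norm_nonneg _) _) hω.le

theorem secondaryTerm_eq (L : ℕ) (α : ℝ) (T : ℕ → Ω → Plane) (ρ : ℕ → Ω → ℝ) (ω : Ω) (n : ℕ) :
    secondaryTerm L α T ρ ω n = (Iio (primaryPower L α T ρ ω)).indicator (fun x => x)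
      (interferencePower α T ρ n ω) := rfl

theorem ofReal_secondaryTerm (L : ℕ) (α : ℝ) (T : ℕ → Ω → Plane) (ρ : ℕ → Ω → ℝ) (ω : Ω) (n : ℕ) :
    ENNReal.ofReal (secondaryTerm L α T ρ ω n) =
      (Iio (primaryPower L α T ρ ω)).indicator ENNReal.ofReal (interferencePower α T ρ n ω) := by
  rw [secondaryTerm_eq]
  by_cases h : interferencePower α T ρ n ω ∈ Iio (primaryPower L α T ρ ω)
  · rw [indicator_of_mem h, indicator_of_mem h]
  · rw [indicator_of_notMem h, indicator_of_notMem h, ENNReal.ofReal_zero]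

theorem secondaryTerm_nonneg {ω : Ω} (h : ∀ n, 0 ≤ interferencePower α T ρ n ω) (n : ℕ) :
    0 ≤ secondaryTerm L α T ρ ω n := by
  rw [secondaryTerm_eq]
  exact Set.indicator_apply_nonneg fun _ => h n

theorem summable_secondaryTerm {ω : Ω} (h : ∀ n, 0 ≤ interferencePower α T ρ n ω)
    (hfin : sumStrictlyBelow (interferencePower α T ρ) (primaryPower L α T ρ ω) ω ≠ ⊤) :
    Summable (secondaryTerm L α T ρ ω) := by
  simp only [sumStrictlyBelow, ← ofReal_secondaryTerm] at hfin
  refine (ENNReal.summable_toReal hfin).congr fun n => ?_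
  rw [ENNReal.toReal_ofReal (secondaryTerm_nonneg h n)]

theorem ofReal_secondaryPower {ω : Ω} (h : ∀ n, 0 ≤ interferencePower α T ρ n ω)
    (hfin : sumStrictlyBelow (interferencePower α T ρ) (primaryPower L α T ρ ω) ω ≠ ⊤) :
    ENNReal.ofReal (secondaryPower L α T ρ ω) =
      sumStrictlyBelow (interferencePower α T ρ) (primaryPower L α T ρ ω) ω := by
  rw [secondaryPower, ENNReal.ofReal_tsum_of_nonneg (secondaryTerm_nonneg h)
    (summable_secondaryTerm h hfin)]
  simp only [ofReal_secondaryTerm, sumStrictlyBelow]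

end Interferers

theorem measurable_sumStrictlyBelow {Ω : Type*} [MeasurableSpace Ω] {X : ℕ → Ω → ℝ}
    (hX : ∀ n, Measurable (X n)) {G : Ω → ℝ} (hG : Measurable G) :
    Measurable fun ω => sumStrictlyBelow X (G ω) ω :=
  Measurable.tsum fun n => ((hX n).ennreal_ofReal).indicator (measurableSet_lt (hX n) hG)

section Interferers

variable {Ω : Type*} {L : ℕ} {α lam : ℝ} {T : ℕ → Ω → Plane} {ρ : ℕ → Ω → ℝ}

theorem primaryPower_eq (L : ℕ) (α : ℝ) (T : ℕ → Ω → Plane) (ρ : ℕ → Ω → ℝ) :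
    primaryPower L α T ρ = fun ω => nthLargest L fun n => interferencePower α T ρ n ω := rfl

/-- The conditional mean of the secondary power, given that the primary power is `g`. -/
noncomputable def secondaryMean (α lam g : ℝ) : ℝ :=
  2 * Real.pi * lam * Real.Gamma (2 / α + 1) / (α - 2) * g ^ (1 - 2 / α)

/-- The conditional variance of the secondary power, given that the primary power is `g`. -/
noncomputable def secondaryVariance (α lam g : ℝ) : ℝ :=
  Real.pi * Real.Gamma (2 / α + 1) * lam / (α - 1) * g ^ (2 - 2 / α)

theorem continuous_secondaryMean (hα : 2 < α) : Continuous (secondaryMean α lam) :=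
  continuous_const.mul (Real.continuous_rpow_const
    (sub_nonneg.2 ((div_lt_one (by linarith)).2 hα).le))

theorem continuous_secondaryVariance (hα : 2 < α) : Continuous (secondaryVariance α lam) :=
  continuous_const.mul (Real.continuous_rpow_const
    (by linarith [(div_lt_one (show 0 < α by linarith)).2 hα]))

theorem secondaryMean_nonneg (hα : 2 < α) (hlam : 0 < lam) {g : ℝ} (hg : 0 ≤ g) :
    0 ≤ secondaryMean α lam g := by
  have := Real.Gamma_pos_of_pos (s := 2 / α + 1) (by positivity)
  have : 0 < α - 2 := by linarith
  unfold secondaryMean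
  positivity

theorem secondaryVariance_nonneg (hα : 2 < α) (hlam : 0 < lam) {g : ℝ} (hg : 0 ≤ g) :
    0 ≤ secondaryVariance α lam g := by
  have := Real.Gamma_pos_of_pos (s := 2 / α + 1) (by positivity)
  have : 0 < α - 1 := by linarith
  unfold secondaryVariance
  positivity

theorem monotoneOn_secondaryMean (hα : 2 < α) (hlam : 0 < lam) :
    MonotoneOn (secondaryMean α lam) (Ici 0) := fun x hx y _ hxy => by
  have := Real.Gamma_pos_of_pos (s := 2 / α + 1) (by positivity)
  have h1 : 0 < α - 2 := by linarith
  exact mul_le_mul_of_nonneg_left (Real.rpow_le_rpow hx hxy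
    (sub_nonneg.2 ((div_lt_one (by linarith)).2 hα).le)) (by positivity)

theorem monotoneOn_secondaryVariance (hα : 2 < α) (hlam : 0 < lam) :
    MonotoneOn (secondaryVariance α lam) (Ici 0) := fun x hx y _ hxy => by
  have := Real.Gamma_pos_of_pos (s := 2 / α + 1) (by positivity)
  have h1 : 0 < α - 1 := by linarith
  exact mul_le_mul_of_nonneg_left (Real.rpow_le_rpow hx hxy
    (by linarith [(div_lt_one (show 0 < α by linarith)).2 hα])) (by positivity)

theorem secondaryMean_zero (hα : 2 < α) : secondaryMean α lam 0 = 0 := by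
  rw [secondaryMean, Real.zero_rpow, mul_zero]
  linarith [(div_lt_one (show 0 < α by linarith)).2 hα]

theorem secondaryVariance_zero (hα : 2 < α) : secondaryVariance α lam 0 = 0 := by
  rw [secondaryVariance, Real.zero_rpow, mul_zero]
  linarith [(div_lt_one (show 0 < α by linarith)).2 hα]

theorem integrableOn_powerIntensity (hα : 2 < α) (hlam : 0 < lam) {g : ℝ} (hg : 0 < g) :
    IntegrableOn (fun y : ℝ => y) (Ioc 0 g) (powerIntensity α lam) := by
  simpa using (integral_pow_powerIntensity hα hlam hg le_rfl).1

theorem integral_powerIntensity (hα : 2 < α) (hlam : 0 < lam) {g : ℝ} (hg : 0 < g) :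
    ∫ y in Ioc 0 g, y ∂(powerIntensity α lam) = secondaryMean α lam g := by
  have h := (integral_pow_powerIntensity hα hlam hg le_rfl).2
  simp only [pow_one, Nat.cast_one] at h
  rw [h, secondaryMean]
  have h0 : α ≠ 0 := by linarith
  have h1 : α - 2 ≠ 0 := by linarith
  have h2 : 1 - 2 / α ≠ 0 := by
    rw [one_sub_div h0]; exact div_ne_zero h1 h0
  congr 1
  -- This is the factor δ/(p - δ) of the truncated moment at p = 1.
  have : 2 / α / (1 - 2 / α) = 2 / (α - 2) := by
    rw [one_sub_div h0]; field_simp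
  rw [this]
  ring

theorem integral_sq_powerIntensity (hα : 2 < α) (hlam : 0 < lam) {g : ℝ} (hg : 0 < g) :
    ∫ y in Ioc 0 g, y ^ 2 ∂(powerIntensity α lam) = secondaryVariance α lam g := by
  have h := (integral_pow_powerIntensity hα hlam hg one_le_two).2
  rw [h, secondaryVariance]
  have h0 : α ≠ 0 := by linarith
  have h1 : α - 1 ≠ 0 := by linarith
  push_cast
  congr 1
  have : 2 / α / (2 - 2 / α) = 1 / (α - 1) := by
    rw [show 2 - 2 / α = 2 * (α - 1) / α by field_simp]; field_simp
  rw [this]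
  ring

theorem powerIntensity_Ioi_ne_top (hα : 2 < α) (hlam : 0 < lam) (x : ℝ) (hx : 0 < x) :
    powerIntensity α lam (Ioi x) ≠ ⊤ := by
  rw [powerIntensity_Ioi (by linarith) hlam hx]
  exact ENNReal.ofReal_ne_top

namespace IsInterfererField

variable [MeasurableSpace Ω] {μ : Measure Ω}

theorem measurable_primaryPower
    (h : IsInterfererField μ lam T ρ) (hL : 1 ≤ L) :
    Measurable (primaryPower L α T ρ) :=
  measurable_nthLargest hL
    (measurable_interferencePower h.poisson.measurable_point h.measurable_fading)

theorem ae_primaryPower_pos [IsProbabilityMeasure μ]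
    (h : IsInterfererField μ lam T ρ) (hL : 1 ≤ L) (hα : 2 < α)
    (hlam : 0 < lam) : ∀ᵐ ω ∂μ, 0 < primaryPower L α T ρ ω := by
  have := Real.Gamma_pos_of_pos (s := 2 / α + 1) (by positivity)
  exact (h.hasPoissonFunctional α hlam).nthLargest_pos hL (by positivity) (by positivity)
    fun x hx => powerIntensity_Ioi (by linarith) hlam hx

theorem map_primaryPower [IsProbabilityMeasure μ]
    (h : IsInterfererField μ lam T ρ) (hL : 1 ≤ L) (hα : 2 < α)
    (hlam : 0 < lam) :
    μ.map (primaryPower L α T ρ) = (volume.restrict (Ioi (0 : ℝ))).withDensity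
      (fun g => ENNReal.ofReal (primaryDensity L α lam g)) := by
  have := Real.Gamma_pos_of_pos (s := 2 / α + 1) (by positivity)
  rw [primaryPower_eq, (h.hasPoissonFunctional α hlam).map_nthLargest hL (δ := 2 / α)
    (c := Real.pi * Real.Gamma (2 / α + 1) * lam) (by positivity) (by positivity)
    fun x hx => powerIntensity_Ioi (by linarith) hlam hx]
  congr 1 with g
  rw [primaryDensity, mul_pow (Real.pi * Real.Gamma (2 / α + 1)) lam, ← mul_assoc (2 / α)]

/-- The first two moments of the secondary power on Borel events of the primary power. -/
theorem setLIntegral_secondary [IsProbabilityMeasure μ]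
    (h : IsInterfererField μ lam T ρ) (hL : 1 ≤ L) (hα : 2 < α)
    (hlam : 0 < lam) {p : ℕ} (hp : p ≠ 0) {m : ℝ → ℝ} (hmc : Continuous m)
    (hmm : MonotoneOn m (Ici 0)) (hm0 : m 0 = 0)
    (hm : ∀ g a, 0 < g → g ≤ a →
      ∫⁻ ω in {ω | countAbove (interferencePower α T ρ) a ω < L},
        sumBelow (interferencePower α T ρ) g ω ^ p ∂μ =
      μ {ω | countAbove (interferencePower α T ρ) a ω < L} * ENNReal.ofReal (m g)) {A : Set ℝ}
    (hA : MeasurableSet A) :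
    ∫⁻ ω in primaryPower L α T ρ ⁻¹' A,
        sumStrictlyBelow (interferencePower α T ρ) (primaryPower L α T ρ ω) ω ^ p ∂μ =
      ∫⁻ x in A, ENNReal.ofReal (m x) ∂(μ.map (primaryPower L α T ρ)) := by
  have hG : Measurable (primaryPower L α T ρ) := h.measurable_primaryPower hL
  have key := (h.hasPoissonFunctional α hlam).setLIntegral_sumStrictlyBelow_pow hL
    (powerIntensity_Ioi_ne_top hα hlam) hp hmc hmm hm0 hm (hA.inter measurableSet_Ioi)
    inter_subset_right
  rw [← primaryPower_eq] at key
  -- The restriction to Borel sets of positive levels is lifted because G > 0 almost surely.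
  have hpos := h.ae_primaryPower_pos (L := L) hL hα hlam
  have h1 : (primaryPower L α T ρ ⁻¹' (A ∩ Ioi 0) : Set Ω) =ᵐ[μ] primaryPower L α T ρ ⁻¹' A := by
    rw [eventuallyEq_set]
    filter_upwards [hpos] with ω hω
    exact ⟨fun hc => hc.1, fun hc => ⟨hc, hω⟩⟩
  have h2 : (A ∩ Ioi 0 : Set ℝ) =ᵐ[μ.map (primaryPower L α T ρ)] A := by
    rw [eventuallyEq_set]
    filter_upwards [(ae_map_iff hG.aemeasurable measurableSet_Ioi).2 hpos] with x hx
    exact ⟨fun hc => hc.1, fun hc => ⟨hc, hx⟩⟩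
  rw [← setLIntegral_congr h1, ← setLIntegral_congr h2]
  exact key

theorem setLIntegral_secondary_one [IsProbabilityMeasure μ]
    (h : IsInterfererField μ lam T ρ) (hL : 1 ≤ L) (hα : 2 < α)
    (hlam : 0 < lam) {A : Set ℝ} (hA : MeasurableSet A) :
    ∫⁻ ω in primaryPower L α T ρ ⁻¹' A,
        sumStrictlyBelow (interferencePower α T ρ) (primaryPower L α T ρ ω) ω ∂μ =
      ∫⁻ x in A, ENNReal.ofReal (secondaryMean α lam x) ∂(μ.map (primaryPower L α T ρ)) := by
  have := h.setLIntegral_secondary hL hα hlam one_ne_zero (continuous_secondaryMean hα)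
    (monotoneOn_secondaryMean hα hlam) (secondaryMean_zero hα) (fun g a hg hga => by
      simp_rw [pow_one]
      rw [(h.hasPoissonFunctional α hlam).setLIntegral_sumBelow hga
        (powerIntensity_Ioi_ne_top hα hlam a (hg.trans_le hga))
        (integrableOn_powerIntensity hα hlam hg), integral_powerIntensity hα hlam hg]) hA
  simpa only [pow_one] using this

theorem setLIntegral_secondary_two [IsProbabilityMeasure μ]
    (h : IsInterfererField μ lam T ρ) (hL : 1 ≤ L) (hα : 2 < α)
    (hlam : 0 < lam) {A : Set ℝ} (hA : MeasurableSet A) :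
    ∫⁻ ω in primaryPower L α T ρ ⁻¹' A,
        sumStrictlyBelow (interferencePower α T ρ) (primaryPower L α T ρ ω) ω ^ 2 ∂μ =
      ∫⁻ x in A, ENNReal.ofReal (secondaryMean α lam x ^ 2 + secondaryVariance α lam x)
        ∂(μ.map (primaryPower L α T ρ)) := by
  refine h.setLIntegral_secondary (m := fun g => secondaryMean α lam g ^ 2 +
    secondaryVariance α lam g) hL hα hlam two_ne_zero
    (((continuous_secondaryMean hα).pow 2).add (continuous_secondaryVariance hα))
    (fun x hx y hy hxy => add_le_add
      (pow_le_pow_left₀ (secondaryMean_nonneg hα hlam hx)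
        (monotoneOn_secondaryMean hα hlam hx hy hxy) 2)
      (monotoneOn_secondaryVariance hα hlam hx hy hxy))
    (by rw [secondaryMean_zero hα, secondaryVariance_zero hα]; norm_num)
    (fun g a hg hga => ?_) hA
  rw [(h.hasPoissonFunctional α hlam).setLIntegral_sumBelow_sq hga
    (powerIntensity_Ioi_ne_top hα hlam a (hg.trans_le hga))
    (integrableOn_powerIntensity hα hlam hg)
    (integral_pow_powerIntensity hα hlam hg one_le_two).1, integral_powerIntensity hα hlam hg,
    integral_sq_powerIntensity hα hlam hg]

theorem measurable_sumStrictlyBelow_primaryPower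
    (h : IsInterfererField μ lam T ρ) (hL : 1 ≤ L) :
    Measurable fun ω => sumStrictlyBelow (interferencePower α T ρ) (primaryPower L α T ρ ω) ω :=
  measurable_sumStrictlyBelow
    (measurable_interferencePower h.poisson.measurable_point h.measurable_fading)
    (h.measurable_primaryPower hL)

theorem ae_sumStrictlyBelow_ne_top [IsProbabilityMeasure μ]
    (h : IsInterfererField μ lam T ρ) (hL : 1 ≤ L) (hα : 2 < α)
    (hlam : 0 < lam) :
    ∀ᵐ ω ∂μ, sumStrictlyBelow (interferencePower α T ρ) (primaryPower L α T ρ ω) ω ≠ ⊤ := by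
  have hG : Measurable (primaryPower L α T ρ) := h.measurable_primaryPower hL
  have : IsProbabilityMeasure (μ.map (primaryPower L α T ρ)) :=
    Measure.isProbabilityMeasure_map hG.aemeasurable
  -- The mean over the whole space can be infinite, so finiteness is shown on each event G ≤ n,
  -- where the conditional mean is bounded by its value at n.
  have hn : ∀ n : ℕ, ∀ᵐ ω ∂μ, ω ∈ primaryPower L α T ρ ⁻¹' Icc 0 (n : ℝ) →
      sumStrictlyBelow (interferencePower α T ρ) (primaryPower L α T ρ ω) ω < ⊤ := fun n => by
    rw [← ae_restrict_iff' (hG measurableSet_Icc)]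
    refine ae_lt_top (h.measurable_sumStrictlyBelow_primaryPower hL) ?_
    rw [h.setLIntegral_secondary_one hL hα hlam measurableSet_Icc]
    refine ne_top_of_le_ne_top (b := ENNReal.ofReal (secondaryMean α lam n) *
      μ.map (primaryPower L α T ρ) (Icc 0 (n : ℝ)))
      (ENNReal.mul_ne_top ENNReal.ofReal_ne_top (measure_ne_top _ _)) ?_
    rw [← setLIntegral_const]
    exact setLIntegral_mono measurable_const fun x hx => ENNReal.ofReal_le_ofReal
      (monotoneOn_secondaryMean hα hlam hx.1 (mem_Ici.2 n.cast_nonneg) hx.2)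
  filter_upwards [ae_all_iff.2 hn] with ω hω
  obtain ⟨n, hn⟩ := exists_nat_ge (primaryPower L α T ρ ω)
  exact (hω n ⟨nthLargest_nonneg _ _, hn⟩).ne

theorem ae_ofReal_secondaryPower [IsProbabilityMeasure μ]
    (h : IsInterfererField μ lam T ρ) (hL : 1 ≤ L) (hα : 2 < α)
    (hlam : 0 < lam) :
    ∀ᵐ ω ∂μ, ENNReal.ofReal (secondaryPower L α T ρ ω) =
      sumStrictlyBelow (interferencePower α T ρ) (primaryPower L α T ρ ω) ω := by
  filter_upwards [h.ae_interferencePower_nonneg α, h.ae_sumStrictlyBelow_ne_top hL hα hlam]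
    with ω h1 h2 using ofReal_secondaryPower h1 h2

theorem ae_secondaryPower_nonneg
    (h : IsInterfererField μ lam T ρ) :
    ∀ᵐ ω ∂μ, 0 ≤ secondaryPower L α T ρ ω := by
  filter_upwards [h.ae_interferencePower_nonneg α] with ω h1
  exact tsum_nonneg (secondaryTerm_nonneg h1)

/-- The real series agrees almost surely with the real part of a series in [0, ∞], whose
measurability is unconditional. -/
theorem aemeasurable_secondaryPower [IsProbabilityMeasure μ]
    (h : IsInterfererField μ lam T ρ) (hL : 1 ≤ L) (hα : 2 < α)
    (hlam : 0 < lam) : AEMeasurable (secondaryPower L α T ρ) μ := by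
  refine ⟨_, (h.measurable_sumStrictlyBelow_primaryPower (α := α) hL).ennreal_toReal, ?_⟩
  filter_upwards [h.ae_ofReal_secondaryPower hL hα hlam, h.ae_secondaryPower_nonneg (L := L)]
    with ω h1 h2
  rw [← h1, ENNReal.toReal_ofReal h2]

end IsInterfererField

end Interferers

theorem lemma2 {Ω : Type*} [MeasurableSpace Ω] (μ : Measure Ω) [IsProbabilityMeasure μ]
    (L : ℕ) (hL : 1 ≤ L) (α lam : ℝ) (hα : 2 < α) (hlam : 0 < lam)
    (T : ℕ → Ω → Plane) (ρ : ℕ → Ω → ℝ) (hfield : IsInterfererField μ lam T ρ) :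
    -- the law of the primary interference power
    (AEMeasurable (primaryPower L α T ρ) μ ∧
      μ.map (primaryPower L α T ρ) =
        (volume.restrict (Ioi (0 : ℝ))).withDensity
          (fun g => ENNReal.ofReal (primaryDensity L α lam g))) ∧
    -- the secondary interference power is a well-defined random variable
    ((∀ᵐ ω ∂μ, Summable (secondaryTerm L α T ρ ω)) ∧
      AEMeasurable (secondaryPower L α T ρ) μ) ∧
    -- its conditional mean and variance, given the primary interference power
    ∀ᵐ g ∂(μ.map (primaryPower L α T ρ)),
      MemLp (fun x : ℝ => x) 2
        (condDistrib (secondaryPower L α T ρ) (primaryPower L α T ρ) μ g) ∧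
      ∫ x, x ∂(condDistrib (secondaryPower L α T ρ) (primaryPower L α T ρ) μ g) =
        2 * Real.pi * lam * Real.Gamma (2 / α + 1) / (α - 2) * g ^ (1 - 2 / α) ∧
      variance (fun x : ℝ => x)
          (condDistrib (secondaryPower L α T ρ) (primaryPower L α T ρ) μ g) =
        Real.pi * Real.Gamma (2 / α + 1) * lam / (α - 1) * g ^ (2 - 2 / α) := by
  have hG : Measurable (primaryPower L α T ρ) := hfield.measurable_primaryPower hL
  have hY : AEMeasurable (secondaryPower L α T ρ) μ :=
    hfield.aemeasurable_secondaryPower hL hα hlam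
  have hofR := hfield.ae_ofReal_secondaryPower hL hα hlam
  refine ⟨⟨hG.aemeasurable, hfield.map_primaryPower hL hα hlam⟩, ⟨?_, hY⟩, ?_⟩
  · filter_upwards [hfield.ae_interferencePower_nonneg α,
      hfield.ae_sumStrictlyBelow_ne_top hL hα hlam] with ω h1 h2
    exact summable_secondaryTerm h1 h2
  -- The test functions y and y² are taken in [0, ∞], so the finite second moment of the conditional
  -- law follows from the formulas instead of being needed for them.
  · have h1 := ae_lintegral_condDistrib_eq (F := ENNReal.ofReal)
      (m := fun x => ENNReal.ofReal (secondaryMean α lam x)) hG hY ENNReal.measurable_ofReal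
      (continuous_secondaryMean hα).measurable.ennreal_ofReal fun A hA => by
        rw [← hfield.setLIntegral_secondary_one hL hα hlam hA]
        refine lintegral_congr_ae (ae_restrict_of_ae ?_)
        filter_upwards [hofR] with ω hω using hω
    have h2 := ae_lintegral_condDistrib_eq (F := fun x => ENNReal.ofReal x ^ 2)
      (m := fun x => ENNReal.ofReal (secondaryMean α lam x ^ 2 + secondaryVariance α lam x)) hG hY
      (ENNReal.measurable_ofReal.pow_const 2)
      (((continuous_secondaryMean hα).pow 2).add
        (continuous_secondaryVariance hα)).measurable.ennreal_ofReal fun A hA => by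
        rw [← hfield.setLIntegral_secondary_two hL hα hlam hA]
        refine lintegral_congr_ae (ae_restrict_of_ae ?_)
        filter_upwards [hofR] with ω hω
        rw [hω]
    have hpos : ∀ᵐ g ∂(μ.map (primaryPower L α T ρ)), 0 ≤ g :=
      (ae_map_iff hG.aemeasurable measurableSet_Ici).2
        (ae_of_all _ fun ω => nthLargest_nonneg _ _)
    filter_upwards [h1, h2, hpos, ae_condDistrib_nonneg hG hY hfield.ae_secondaryPower_nonneg]
      with g hg1 hg2 hg0 hgn
    exact moments_of_lintegral hgn (secondaryMean_nonneg hα hlam hg0)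
      (secondaryVariance_nonneg hα hlam hg0) hg1 hg2
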